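/- Let $p$ be a prime number. Let $\mathcal{C}$ be Köhler's $\mathbb{Z}$-linear category, presented as follows. It has six objects $A_0, A_1, A_2, \Sigma A_0, \Sigma A_1, \Sigma A_2$. It is generated, as a $\mathbb{Z}$-linear category, by the arrows $${}_0t_0\colon A_0\to A_0,\quad {}_1s_1\colon A_1\to A_1,\quad {}_2s_2,\,{}_2t_2\colon A_2\to A_2,$$ $${}_1\alpha_0\colon A_0\to A_1,\quad {}_0\alpha_1\colon A_1\to A_0,\quad {}_2\alpha_0\colon A_0\to A_2,\quad {}_0\alpha_2\colon A_2\to A_0,\quad {}_2\alpha_1\colon \Sigma A_1\to A_2,\quad {}_1\alpha_2\colon A_2\to\Sigma A_1$$ together with their images under the involution $\Sigma$ (which exchanges $A_i$ and $\Sigma A_i$, with $\Sigma\Sigma=\mathrm{id}$), subject to the following relations and their images under $\Sigma$, where $N(x):=\sum_{i=0}^{p-1}x^i$: - $(\rho 1)$ ${}_2\alpha_1\circ\Sigma{}_1\alpha_0=0$, $\ \Sigma{}_0\alpha_1\circ{}_1\alpha_2=0$, $\ {}_0\alpha_2\circ{}_2\alpha_1=0$, $\ {}_1\alpha_2\circ{}_2\alpha_0=0$,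 $\ {}_1\alpha_0\circ{}_0\alpha_2=0$, $\ {}_2\alpha_0\circ{}_0\alpha_1=0$; - $(\rho 2)$ ${}_0\alpha_1\circ{}_1\alpha_0=N({}_0t_0)$, $\ {}_1\alpha_0\circ{}_0\alpha_1=N({}_1s_1)$; - $(\rho 3)$ ${}_0\alpha_2\circ{}_2\alpha_0=\mathrm{id}_{A_0}-{}_0t_0$, $\ {}_2\alpha_0\circ{}_0\alpha_2=\mathrm{id}_{A_2}-{}_2t_2$; - $(\rho 4)$ ${}_1\alpha_2\circ{}_2\alpha_1=\mathrm{id}_{\Sigma A_1}-\Sigma{}_1s_1$, $\ {}_2\alpha_1\circ{}_1\alpha_2=\mathrm{id}_{A_2}-{}_2s_2$; - $(\rho 5)$ $N({}_2t_2)+N({}_2s_2)=p\cdot\mathrm{id}_{A_2}$. Then $\mathcal{C}$ is $1$-Gorenstein. That is, the category $\mathcal{A}=\mathrm{Mod}\,\mathcal{C}$ of $\mathbb{Z}$-linear functors $\mathcal{C}^{\mathrm{op}}\to\mathrm{Mod}\,\mathbb{Z}$ is a Grothendieck category such that 1. for every $M\in\mathcal{A}$, $\operatorname{pd}M<\infty$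 if and only if $\operatorname{id}M<\infty$; 2. the finitary projective dimension $\sup\{\operatorname{pd}M : M\in\mathcal A,\ \operatorname{pd}M<\infty\}$ and the finitary injective dimension $\sup\{\operatorname{id}M : M\in\mathcal A,\ \operatorname{id}M<\infty\}$ are finite; 3. $\mathcal{A}$ has a generator of finite projective dimension; and the Gorenstein dimension of $\mathcal{A}$ is $1$, i.e. its finitary projective and finitary injective dimensions are both equal to $1$. -/

import Mathlib

open CategoryTheory CategoryTheory.Limits
open scoped ZeroObject

universe v u v₁ u₁ v₂ u₂

noncomputable section

/-! ## Gorenstein categories -/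

section Gorenstein

variable (A : Type u) [Category.{v} A] [Abelian A]

/-- The finitary projective dimension `sup {pd X | pd X < ∞}` of an abelian category. -/
def finitaryProjectiveDimension : WithBot ℕ∞ :=
  ⨆ (X : A) (_ : projectiveDimension X < ⊤), projectiveDimension X

/-- The finitary injective dimension `sup {id X | id X < ∞}` of an abelian category. -/
def finitaryInjectiveDimension : WithBot ℕ∞ :=
  ⨆ (X : A) (_ : injectiveDimension X < ⊤), injectiveDimension X

/-- A Gorenstein category: a Grothendieck category (with respect to the universe of its
morphisms) in which the objects of finite projective dimension are those of finite injective
dimension, whose finitary projective and injective dimensions are finite, and which has a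
generator of finite projective dimension. -/
structure IsGorensteinCategory : Prop where
  isGrothendieck : IsGrothendieckAbelian.{v} A
  projectiveDimension_lt_top_iff (X : A) :
    projectiveDimension X < ⊤ ↔ injectiveDimension X < ⊤
  finitaryProjectiveDimension_lt_top : finitaryProjectiveDimension A < ⊤
  finitaryInjectiveDimension_lt_top : finitaryInjectiveDimension A < ⊤
  exists_generator : ∃ G : A, IsSeparator G ∧ projectiveDimension G < ⊤

/-- An `n`-Gorenstein category: a Gorenstein category of Gorenstein dimension `n`, i.e. its
finitary projective dimension and its finitary injective dimension are both equal to `n`. -/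
structure IsNGorensteinCategory (n : ℕ) : Prop extends IsGorensteinCategory A where
  finitaryProjectiveDimension_eq : finitaryProjectiveDimension A = n
  finitaryInjectiveDimension_eq : finitaryInjectiveDimension A = n

end Gorenstein

/-! ## Modules over a preadditive (that is, `ℤ`-linear) category -/

section AdditiveFunctors

variable (C : Type u₁) [Category.{v₁} C] [Preadditive C]
  (D : Type u₂) [Category.{v₂} D] [Abelian D]

instance additiveFunctor_isClosedUnderSubobjects :
    (additiveFunctor C D).IsClosedUnderSubobjects where
  prop_of_mono {F G} α _ hG := by
    have hG' : G.Additive := hG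
    refine (additiveFunctor_iff F).2 ⟨fun {X Y f g} => ?_⟩
    rw [← cancel_mono (α.app Y)]
    simp [Preadditive.add_comp, Preadditive.comp_add]

instance additiveFunctor_isClosedUnderQuotients :
    (additiveFunctor C D).IsClosedUnderQuotients where
  prop_of_epi {F G} α _ hF := by
    have hF' : F.Additive := hF
    refine (additiveFunctor_iff G).2 ⟨fun {X Y f g} => ?_⟩
    rw [← cancel_epi (α.app X)]
    simp [Preadditive.add_comp, Preadditive.comp_add, ← NatTrans.naturality]

instance additiveFunctor_containsZero : (additiveFunctor C D).ContainsZero where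
  exists_zero := ⟨0, isZero_zero _, ⟨fun {_ Y _ _} =>
    ((Functor.isZero_iff (0 : C ⥤ D)).1 (isZero_zero _) Y).eq_of_tgt _ _⟩⟩

instance additiveFunctor_isClosedUnderFiniteProducts :
    (additiveFunctor C D).IsClosedUnderFiniteProducts where
  isClosedUnderLimitsOfShape J _ := ⟨by
    rintro F ⟨p⟩
    refine (additiveFunctor_iff F).2 ⟨fun {X Y f g} => ?_⟩
    refine (isLimitOfPreserves ((evaluation C D).obj Y) p.isLimit).hom_ext fun j => ?_
    have hj : (p.diag.obj j).Additive := p.prop_diag_obj j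
    have h := fun (k : X ⟶ Y) => (p.π.app j).naturality k
    simp only [Functor.const_obj_obj] at h
    simp [Preadditive.add_comp, Preadditive.comp_add, h]⟩

/-- Additive functors from a preadditive category to an abelian category form an abelian
category. -/
instance additiveFunctorAbelian : Abelian (C ⥤+ D) :=
  inferInstanceAs (Abelian (additiveFunctor C D).FullSubcategory)

end AdditiveFunctors

section Modules

variable (C : Type) [SmallCategory C] [Preadditive C]

/-- The category `Mod C` of right modules over a small `ℤ`-linear category:
`ℤ`-linear (equivalently, additive) functors from `Cᵒᵖ` to `ℤ`-modules. -/
abbrev RightModules : Type _ := Cᵒᵖ ⥤+ ModuleCat.{0} ℤ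

/-- A small preadditive category `C` is `n`-Gorenstein if `Mod C` is. -/
def IsNGorenstein (n : ℕ) : Prop := IsNGorensteinCategory (RightModules C) n

end Modules

/-! ## Presentations of preadditive categories -/

section Presentation

variable {C : Type u} [Category.{v} C] [Preadditive C]

/-- The additive congruence generated by a relation `r` on the morphisms of a preadditive
category: `f` and `g` are related iff `f - g` lies in the two-sided ideal generated by the
differences of the pairs in `r`. -/
inductive AdditiveCongruence (r : HomRel C) : HomRel C
  | of {X Y : C} {f g : X ⟶ Y} : r f g → AdditiveCongruence r f g
  | refl {X Y : C} (f : X ⟶ Y) : AdditiveCongruence r f f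
  | symm {X Y : C} {f g : X ⟶ Y} : AdditiveCongruence r f g → AdditiveCongruence r g f
  | trans {X Y : C} {f g h : X ⟶ Y} :
      AdditiveCongruence r f g → AdditiveCongruence r g h → AdditiveCongruence r f h
  | add {X Y : C} {f f' g g' : X ⟶ Y} :
      AdditiveCongruence r f f' → AdditiveCongruence r g g' →
        AdditiveCongruence r (f + g) (f' + g')
  | precomp {X Y Z : C} (f : X ⟶ Y) {g g' : Y ⟶ Z} :
      AdditiveCongruence r g g' → AdditiveCongruence r (f ≫ g) (f ≫ g')
  | postcomp {X Y Z : C} {f f' : X ⟶ Y} (g : Y ⟶ Z) :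
      AdditiveCongruence r f f' → AdditiveCongruence r (f ≫ g) (f' ≫ g)

instance (r : HomRel C) : Congruence (AdditiveCongruence r) where
  equivalence := ⟨.refl, .symm, .trans⟩
  comp_left f _ _ h := .precomp f h
  comp_right g h := .postcomp g h

/-- The quotient of a preadditive category by the relations `r`. -/
abbrev AdditiveQuotient (r : HomRel C) : Type u :=
  CategoryTheory.Quotient (AdditiveCongruence r)

instance (r : HomRel C) : Preadditive (AdditiveQuotient r) :=
  CategoryTheory.Quotient.preadditive (AdditiveCongruence r) fun _ _ _ _ _ _ h₁ h₂ => .add h₁ h₂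

/-- `N(x) = 1 + x + ⋯ + x ^ (p - 1)` for an endomorphism `x`. -/
def normSum (p : ℕ) {X : C} (x : X ⟶ X) : X ⟶ X :=
  ∑ i ∈ Finset.range p, ((show End X from x) ^ i : End X)

end Presentation

/-! ## Köhler's category -/

/-- The objects `A₀, A₁, A₂, ΣA₀, ΣA₁, ΣA₂`. The flag `ε` is `false` for `Aᵢ` and `true` for
`ΣAᵢ`, so the involution `Σ` is `ε ↦ !ε`. -/
inductive KohlerObj : Type
  | A₀ (ε : Bool)
  | A₁ (ε : Bool)
  | A₂ (ε : Bool)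

open KohlerObj

/-- The arrows of the generating quiver. For `ε = false` these are
`t₀ : A₀ → A₀`, `s₁ : A₁ → A₁`, `s₂, t₂ : A₂ → A₂` and the arrows `αⱼᵢ` (written `ⱼαᵢ` in
index notation), where `α₁₀ : A₀ → A₁`, `α₂₀ : A₀ → A₂`, `α₀₁ : A₁ → A₀`,
`α₂₁ : ΣA₁ → A₂`, `α₀₂ : A₂ → A₀`, `α₁₂ : A₂ → ΣA₁`; for `ε = true` they are the suspensions
of these, with `ΣΣ = id`. -/
inductive KohlerArrow : KohlerObj → KohlerObj → Type
  | t₀ (ε : Bool) : KohlerArrow (A₀ ε) (A₀ ε)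
  | s₁ (ε : Bool) : KohlerArrow (A₁ ε) (A₁ ε)
  | s₂ (ε : Bool) : KohlerArrow (A₂ ε) (A₂ ε)
  | t₂ (ε : Bool) : KohlerArrow (A₂ ε) (A₂ ε)
  | α₁₀ (ε : Bool) : KohlerArrow (A₀ ε) (A₁ ε)
  | α₂₀ (ε : Bool) : KohlerArrow (A₀ ε) (A₂ ε)
  | α₀₁ (ε : Bool) : KohlerArrow (A₁ ε) (A₀ ε)
  | α₂₁ (ε : Bool) : KohlerArrow (A₁ !ε) (A₂ ε)
  | α₀₂ (ε : Bool) : KohlerArrow (A₂ ε) (A₀ ε)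
  | α₁₂ (ε : Bool) : KohlerArrow (A₂ ε) (A₁ !ε)

instance : Quiver KohlerObj := ⟨KohlerArrow⟩

/-- The free `ℤ`-linear category on the quiver. -/
abbrev KohlerFree : Type := Free ℤ (Paths KohlerObj)

/-- An object of the quiver as an object of the free `ℤ`-linear category. -/
abbrev kohlerOb (X : KohlerObj) : KohlerFree :=
  (Free.embedding ℤ (Paths KohlerObj)).obj ((Paths.of KohlerObj).obj X)

/-- An arrow of the quiver as a morphism of the free `ℤ`-linear category. -/
abbrev kohlerGen {X Y : KohlerObj} (a : KohlerArrow X Y) : kohlerOb X ⟶ kohlerOb Y :=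
  (Free.embedding ℤ (Paths KohlerObj)).map ((Paths.of KohlerObj).map a)

open KohlerArrow in
/-- The defining relations, each together with its suspension. Here `f ≫ g` is `g ∘ f`. -/
inductive KohlerRel (p : ℕ) : HomRel KohlerFree
  | rho1a (ε : Bool) : KohlerRel p (kohlerGen (α₁₀ !ε) ≫ kohlerGen (α₂₁ ε)) 0
  | rho1b (ε : Bool) : KohlerRel p (kohlerGen (α₁₂ ε) ≫ kohlerGen (α₀₁ !ε)) 0
  | rho1c (ε : Bool) : KohlerRel p (kohlerGen (α₂₁ ε) ≫ kohlerGen (α₀₂ ε)) 0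
  | rho1d (ε : Bool) : KohlerRel p (kohlerGen (α₂₀ ε) ≫ kohlerGen (α₁₂ ε)) 0
  | rho1e (ε : Bool) : KohlerRel p (kohlerGen (α₀₂ ε) ≫ kohlerGen (α₁₀ ε)) 0
  | rho1f (ε : Bool) : KohlerRel p (kohlerGen (α₀₁ ε) ≫ kohlerGen (α₂₀ ε)) 0
  | rho2a (ε : Bool) :
      KohlerRel p (kohlerGen (α₁₀ ε) ≫ kohlerGen (α₀₁ ε)) (normSum p (kohlerGen (t₀ ε)))
  | rho2b (ε : Bool) :
      KohlerRel p (kohlerGen (α₀₁ ε) ≫ kohlerGen (α₁₀ ε)) (normSum p (kohlerGen (s₁ ε)))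
  | rho3a (ε : Bool) :
      KohlerRel p (kohlerGen (α₂₀ ε) ≫ kohlerGen (α₀₂ ε)) (𝟙 _ - kohlerGen (t₀ ε))
  | rho3b (ε : Bool) :
      KohlerRel p (kohlerGen (α₀₂ ε) ≫ kohlerGen (α₂₀ ε)) (𝟙 _ - kohlerGen (t₂ ε))
  | rho4a (ε : Bool) :
      KohlerRel p (kohlerGen (α₂₁ ε) ≫ kohlerGen (α₁₂ ε)) (𝟙 _ - kohlerGen (s₁ !ε))
  | rho4b (ε : Bool) :
      KohlerRel p (kohlerGen (α₁₂ ε) ≫ kohlerGen (α₂₁ ε)) (𝟙 _ - kohlerGen (s₂ ε))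
  | rho5 (ε : Bool) :
      KohlerRel p (normSum p (kohlerGen (t₂ ε)) + normSum p (kohlerGen (s₂ ε)))
        (p • 𝟙 (kohlerOb (A₂ ε)))

/-- Köhler's `ℤ`-linear category for the prime `p`: generated by the quiver above, subject to
the relations above. -/
abbrev KohlerCategory (p : ℕ) : Type := AdditiveQuotient (KohlerRel p)

end

/-!
Köhler's category `C` behaves like a Frobenius algebra over `ℤ`, and its Gorenstein dimension is
therefore the global dimension of `ℤ`, which is one.

Suppose that for every object `X` there is an additive functional `λ_X : End X → ℤ` such that all
composition pairings `C(X, W) × C(W, X) → End X → ℤ` are perfect (`FrobeniusForm`). Evaluation at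
`X`, from right `C`-modules to `ℤ`-modules, is exact and has, over any `C`, the right adjoint
`coind X E = Hom_ℤ(C(X, -), E)`; dual bases for the pairings make the same functor a left adjoint
as well (`RightModules.coindAdjEval`). Thus `coind X` is exact and preserves projectives and
injectives, so every `coind X E` has projective and injective dimension at most one. As there are
finitely many objects and the evaluations are jointly faithful, every module is a quotient and a
submodule of the finite biproduct of the modules `coind X (M X)`. Hence a projective module, being a
direct summand of such a biproduct, has injective dimension at most one, and an injective module has
projective dimension at most one. Dimension shifting extends this to all modules of finite
projective or injective dimension (`isNGorensteinCategory_one`), and the bound one is attained by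
`coind X (ℤ / 2)` and `coind X ℤ` (`FrobeniusForm.isNGorenstein_one`).

It remains to find the functionals for Köhler's category. Put `x₀ = 1 - t₀`, `y₁ = 1 - s₁`,
`x₂ = 1 - t₂`, `y₂ = 1 - s₂`. The relations show that each `C(X, Y)` is spanned by explicit
products of at most one arrow `αⱼᵢ` and a power of one of these loops
(`KohlerCategory.basisSpan_eq_top`); here it matters that `N (1 - x)` has top coefficient `±1`. Over
`K = ℚ[x] / N (1 - x)` the relations are satisfied by `2 × 2` matrices
(`KohlerCategory.genFunctor_map_rel`). Composing the resulting supertrace `End X → K` with the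
functional `μ : K → ℚ` that vanishes on `x, ..., x ^ (p - 2)` and is `1` on `x ^ (p - 1)` gives
functionals which are integral on the spanning sets
(`KohlerCategory.exists_isNondegenerateForm`), although `μ 1 = ∓ 1 / p` is not: the supertrace
of the identity is zero. In terms of the spanning sets the Gram matrices are block triangular, the
blocks being Hankel matrices with zeros above the antidiagonal and `±1` on it, so they are
invertible over `ℤ`
(`KohlerCategory.IsNondegenerateForm.isUnit_det`). In particular the spanning sets are bases, but
this is never needed separately.
-/

open CategoryTheory CategoryTheory.Limits
open scoped ZeroObject

open Opposite KohlerObj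

noncomputable section

attribute [local instance] Abelian.hasFiniteBiproducts

/-! ### Homological dimensions of finite biproducts -/

section FiniteBiproducts

variable {A : Type u} [Category.{v} A] [Abelian A] {ι : Type} [Finite ι]

lemma hasInjectiveDimensionLT_biproduct (X : ι → A) (n : ℕ)
    (h : ∀ i, HasInjectiveDimensionLT (X i) n) : HasInjectiveDimensionLT (⨁ X) n := by
  have := Fintype.ofFinite ι
  classical
  let := HasExt.standard A
  rw [hasInjectiveDimensionLT_iff]
  intro i hi T x
  rw [← x.comp_mk₀_id, ← biproduct.total, Abelian.Ext.mk₀_sum, Abelian.Ext.comp_sum]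
  refine Finset.sum_eq_zero fun j _ => ?_
  rw [← Abelian.Ext.mk₀_comp_mk₀, ← Abelian.Ext.comp_assoc_of_second_deg_zero,
    (x.comp (Abelian.Ext.mk₀ (biproduct.π X j)) (add_zero i)).eq_zero_of_hasInjectiveDimensionLT
      n hi, Abelian.Ext.zero_comp]

lemma hasProjectiveDimensionLT_biproduct (X : ι → A) (n : ℕ)
    (h : ∀ i, HasProjectiveDimensionLT (X i) n) : HasProjectiveDimensionLT (⨁ X) n := by
  have := Fintype.ofFinite ι
  classical
  let := HasExt.standard A
  rw [hasProjectiveDimensionLT_iff]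
  intro i hi T x
  rw [← x.mk₀_id_comp, ← biproduct.total, Abelian.Ext.mk₀_sum, Abelian.Ext.sum_comp]
  refine Finset.sum_eq_zero fun j _ => ?_
  rw [← Abelian.Ext.mk₀_comp_mk₀, Abelian.Ext.comp_assoc_of_second_deg_zero,
    ((Abelian.Ext.mk₀ (biproduct.ι X j)).comp x (zero_add i)).eq_zero_of_hasProjectiveDimensionLT
      n hi, Abelian.Ext.comp_zero]

end FiniteBiproducts

/-! ### Principal ideal domains have global dimension at most one -/

section Hereditary

variable {B : Type u} [Category.{v} B] [Abelian B]

lemma hasProjectiveDimensionLT_of_forall_hasInjectiveDimensionLT (n : ℕ)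
    (h : ∀ X : B, HasInjectiveDimensionLT X n) (X : B) : HasProjectiveDimensionLT X n := by
  let := HasExt.standard B
  rw [hasProjectiveDimensionLT_iff]
  intro i hi Y e
  have := h Y
  exact e.eq_zero_of_hasInjectiveDimensionLT n hi

/-- Ideals of a principal ideal domain are projective, so Baer's criterion passes to quotients. -/
lemma Module.Baer.of_surjective {R : Type u} [CommRing R] [IsDomain R] [IsPrincipalIdealRing R]
    {I : Type v} {Q : Type v₁} [AddCommGroup I] [Module R I] [AddCommGroup Q] [Module R Q]
    (f : I →ₗ[R] Q) (hf : Function.Surjective f) (hI : Module.Baer R I) : Module.Baer R Q := by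
  intro J g
  obtain ⟨h, hh⟩ := Module.projective_lifting_property f g hf
  obtain ⟨k, hk⟩ := hI J h
  exact ⟨f ∘ₗ k, fun x hx => by
    rw [LinearMap.comp_apply, hk x hx, ← LinearMap.comp_apply, hh]⟩

lemma ModuleCat.hasInjectiveDimensionLE_one_of_isPrincipalIdealRing {R : Type u} [CommRing R]
    [IsDomain R] [IsPrincipalIdealRing R] (E : ModuleCat.{u} R) :
    HasInjectiveDimensionLE E 1 := by
  obtain ⟨P⟩ := EnoughInjectives.presentation E
  have hS : (ShortComplex.mk _ _ (cokernel.condition P.f)).ShortExact :=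
    { exact := ShortComplex.exact_cokernel P.f }
  have h1 : Module.Injective R P.J :=
    (Module.injective_iff_injective_object R P.J).2 P.injective
  have h2 : Module.Injective R (cokernel P.f : ModuleCat R) :=
    ((Module.Baer.of_injective h1).of_surjective (cokernel.π P.f).hom
      ((ModuleCat.epi_iff_surjective _).1 inferInstance)).injective
  have h3 : Injective (cokernel P.f) := (Module.injective_iff_injective_object R _).1 h2
  exact hS.hasInjectiveDimensionLT_X₁ 1
    (inferInstanceAs (HasInjectiveDimensionLT (cokernel P.f) 1))
    (inferInstanceAs (HasInjectiveDimensionLT P.J (1 + 1)))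

end Hereditary

/-! ### Families of adjunctions on both sides -/

section Ambidextrous

variable {A : Type u₁} [Category.{v₁} A] [Abelian A] {B : Type u₂} [Category.{v₂} B] [Abelian B]

section SingleAdjunction

variable {G : A ⥤ B} {F : B ⥤ A}

/-- If `F` is both a left and a right adjoint of `G`, it is exact and preserves projectives, so it
carries projective resolutions of length one to projective resolutions of length one. -/
lemma hasProjectiveDimensionLE_one_of_adjunctions [EnoughProjectives B] (adjl : F ⊣ G)
    (adjr : G ⊣ F) (hB : ∀ E : B, HasInjectiveDimensionLE E 1) (E : B) :
    HasProjectiveDimensionLE (F.obj E) 1 := by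
  have := adjl.leftAdjoint_preservesColimits
  have := adjr.rightAdjoint_preservesLimits
  have := adjl.rightAdjoint_preservesLimits
  have := adjr.leftAdjoint_preservesColimits
  have := Functor.additive_of_preserves_binary_products F
  obtain ⟨P⟩ := EnoughProjectives.presentation E
  have hS : (ShortComplex.mk _ _ (kernel.condition P.f)).ShortExact :=
    { exact := ShortComplex.exact_kernel P.f }
  have h1 : HasProjectiveDimensionLT (kernel P.f) 1 :=
    hS.hasProjectiveDimensionLT_X₁ 1 (inferInstanceAs (HasProjectiveDimensionLT P.p 1))
      (hasProjectiveDimensionLT_of_forall_hasInjectiveDimensionLT 2 hB E)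
  have : Projective (F.obj (kernel P.f)) := adjl.map_projective _ inferInstance
  have : Projective (F.obj P.p) := adjl.map_projective _ inferInstance
  exact (hS.map_of_exact F).hasProjectiveDimensionLT_X₃ 1
    (inferInstanceAs (HasProjectiveDimensionLT (F.obj (kernel P.f)) 1))
    (inferInstanceAs (HasProjectiveDimensionLT (F.obj P.p) (1 + 1)))

lemma hasInjectiveDimensionLE_one_of_adjunctions [EnoughInjectives B] (adjl : F ⊣ G)
    (adjr : G ⊣ F) (hB : ∀ E : B, HasInjectiveDimensionLE E 1) (E : B) :
    HasInjectiveDimensionLE (F.obj E) 1 := by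
  have := adjl.leftAdjoint_preservesColimits
  have := adjr.rightAdjoint_preservesLimits
  have := adjl.rightAdjoint_preservesLimits
  have := adjr.leftAdjoint_preservesColimits
  have := Functor.additive_of_preserves_binary_products F
  obtain ⟨P⟩ := EnoughInjectives.presentation E
  have hS : (ShortComplex.mk _ _ (cokernel.condition P.f)).ShortExact :=
    { exact := ShortComplex.exact_cokernel P.f }
  have h1 : HasInjectiveDimensionLT (cokernel P.f) 1 :=
    hS.hasInjectiveDimensionLT_X₃ 1 (inferInstanceAs (HasInjectiveDimensionLT P.J 1)) (hB E)
  have : Injective (F.obj (cokernel P.f)) := adjr.map_injective _ inferInstance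
  have : Injective (F.obj P.J) := adjr.map_injective _ inferInstance
  exact (hS.map_of_exact F).hasInjectiveDimensionLT_X₁ 1
    (inferInstanceAs (HasInjectiveDimensionLT (F.obj (cokernel P.f)) 1))
    (inferInstanceAs (HasInjectiveDimensionLT (F.obj P.J) (1 + 1)))

end SingleAdjunction

variable {ι : Type} [Finite ι] {G : ι → A ⥤ B} {F : ι → B ⥤ A}

/-- The sum of the counits of a finite family of adjunctions `F i ⊣ G i`. -/
def counitSum (adjl : ∀ i, F i ⊣ G i) (M : A) : (⨁ fun i => (F i).obj ((G i).obj M)) ⟶ M :=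
  biproduct.desc fun i => (adjl i).counit.app M

/-- The product of the units of a finite family of adjunctions `G i ⊣ F i`. -/
def unitProd (adjr : ∀ i, G i ⊣ F i) (M : A) : M ⟶ ⨁ fun i => (F i).obj ((G i).obj M) :=
  biproduct.lift fun i => (adjr i).unit.app M

/-- The condition `hG` says that the functors `G i` are jointly faithful. -/
lemma epi_counitSum (adjl : ∀ i, F i ⊣ G i)
    (hG : ∀ {X Y : A} (f : X ⟶ Y), (∀ i, (G i).map f = 0) → f = 0) (M : A) :
    Epi (counitSum adjl M) := by
  refine Preadditive.epi_of_cancel_zero _ fun {Z} f hf => hG f fun i => ?_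
  have h : (adjl i).counit.app M ≫ f = 0 := by
    simpa [counitSum] using biproduct.ι (fun i => (F i).obj ((G i).obj M)) i ≫= hf
  have := (adjl i).isRightAdjoint
  rw [← Category.id_comp ((G i).map f)]
  refine (congrArg (· ≫ (G i).map f) ((adjl i).right_triangle_components M).symm).trans ?_
  have h' : (G i).map ((adjl i).counit.app M) ≫ (G i).map f = 0 := by
    rw [← Functor.map_comp, h, Functor.map_zero]
  rw [Category.assoc]
  exact (congrArg _ h').trans comp_zero

lemma mono_unitProd (adjr : ∀ i, G i ⊣ F i)
    (hG : ∀ {X Y : A} (f : X ⟶ Y), (∀ i, (G i).map f = 0) → f = 0) (M : A) :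
    Mono (unitProd adjr M) := by
  refine Preadditive.mono_of_cancel_zero _ fun {Z} f hf => hG f fun i => ?_
  have h : f ≫ (adjr i).unit.app M = 0 := by
    simpa [unitProd] using hf =≫ biproduct.π (fun i => (F i).obj ((G i).obj M)) i
  rw [← Category.comp_id ((G i).map f)]
  refine (congrArg ((G i).map f ≫ ·) ((adjr i).left_triangle_components M).symm).trans ?_
  have h' : (G i).map f ≫ (G i).map ((adjr i).unit.app M) = 0 := by
    have := (adjr i).leftAdjoint_preservesColimits
    rw [← Functor.map_comp, h, Functor.map_zero]
  rw [← Category.assoc]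
  exact (congrArg (· ≫ _) h').trans zero_comp

lemma enoughProjectives_of_adjunctions [EnoughProjectives B] (adjl : ∀ i, F i ⊣ G i)
    (adjr : ∀ i, G i ⊣ F i)
    (hG : ∀ {X Y : A} (f : X ⟶ Y), (∀ i, (G i).map f = 0) → f = 0) : EnoughProjectives A where
  presentation M := by
    have := epi_counitSum adjl hG M
    have h1 (i : ι) : HasProjectiveDimensionLT ((F i).obj (Projective.over ((G i).obj M))) 1 := by
      have := (adjr i).leftAdjoint_preservesColimits
      have : Projective ((F i).obj (Projective.over ((G i).obj M))) :=
        (adjl i).map_projective _ inferInstance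
      infer_instance
    have h2 := hasProjectiveDimensionLT_biproduct _ 1 h1
    have (i : ι) : Epi ((F i).map (Projective.π ((G i).obj M))) :=
      have := (adjl i).leftAdjoint_preservesColimits
      inferInstance
    exact ⟨{ p := ⨁ fun i => (F i).obj (Projective.over ((G i).obj M))
             projective := projective_iff_hasProjectiveDimensionLT_one.2 h2
             f := biproduct.map (fun i => (F i).map (Projective.π ((G i).obj M))) ≫
               counitSum adjl M
             epi := epi_comp _ _ }⟩

lemma enoughInjectives_of_adjunctions [EnoughInjectives B] (adjl : ∀ i, F i ⊣ G i)
    (adjr : ∀ i, G i ⊣ F i)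
    (hG : ∀ {X Y : A} (f : X ⟶ Y), (∀ i, (G i).map f = 0) → f = 0) : EnoughInjectives A where
  presentation M := by
    have := mono_unitProd adjr hG M
    have h1 (i : ι) : HasInjectiveDimensionLT ((F i).obj (Injective.under ((G i).obj M))) 1 := by
      have := (adjl i).rightAdjoint_preservesLimits
      have : Injective ((F i).obj (Injective.under ((G i).obj M))) :=
        (adjr i).map_injective _ inferInstance
      infer_instance
    have h2 := hasInjectiveDimensionLT_biproduct _ 1 h1
    have (i : ι) : Mono ((F i).map (Injective.ι ((G i).obj M))) :=
      have := (adjr i).rightAdjoint_preservesLimits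
      inferInstance
    exact ⟨{ J := ⨁ fun i => (F i).obj (Injective.under ((G i).obj M))
             injective := injective_iff_hasInjectiveDimensionLT_one.2 h2
             f := unitProd adjr M ≫
               biproduct.map (fun i => (F i).map (Injective.ι ((G i).obj M)))
             mono := mono_comp _ _ }⟩

/-- A projective object is a direct summand of `⨁ F i (G i P)`. -/
lemma hasInjectiveDimensionLE_one_of_projective [EnoughInjectives B] (adjl : ∀ i, F i ⊣ G i)
    (adjr : ∀ i, G i ⊣ F i)
    (hG : ∀ {X Y : A} (f : X ⟶ Y), (∀ i, (G i).map f = 0) → f = 0)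
    (hB : ∀ E : B, HasInjectiveDimensionLE E 1) (P : A) [Projective P] :
    HasInjectiveDimensionLE P 1 := by
  have := epi_counitSum adjl hG P
  have : HasInjectiveDimensionLT (⨁ fun i => (F i).obj ((G i).obj P)) 2 :=
    hasInjectiveDimensionLT_biproduct _ _ fun i =>
      hasInjectiveDimensionLE_one_of_adjunctions (adjl i) (adjr i) hB _
  exact Retract.hasInjectiveDimensionLT
    ⟨Projective.factorThru (𝟙 P) (counitSum adjl P), counitSum adjl P,
      Projective.factorThru_comp _ _⟩ 2

/-- An injective object is a direct summand of `⨁ F i (G i J)`. -/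
lemma hasProjectiveDimensionLE_one_of_injective [EnoughProjectives B] (adjl : ∀ i, F i ⊣ G i)
    (adjr : ∀ i, G i ⊣ F i)
    (hG : ∀ {X Y : A} (f : X ⟶ Y), (∀ i, (G i).map f = 0) → f = 0)
    (hB : ∀ E : B, HasInjectiveDimensionLE E 1) (J : A) [Injective J] :
    HasProjectiveDimensionLE J 1 := by
  have := mono_unitProd adjr hG J
  have : HasProjectiveDimensionLT (⨁ fun i => (F i).obj ((G i).obj J)) 2 :=
    hasProjectiveDimensionLT_biproduct _ _ fun i =>
      hasProjectiveDimensionLE_one_of_adjunctions (adjl i) (adjr i) hB _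
  exact Retract.hasProjectiveDimensionLT
    ⟨unitProd adjr J, Injective.factorThru (𝟙 J) (unitProd adjr J),
      Injective.comp_factorThru _ _⟩ 2

end Ambidextrous

/-! ### Gorenstein categories of dimension one -/

section DimensionOne

variable {A : Type u} [Category.{v} A] [Abelian A]

/-- In a short exact sequence `0 ⟶ K ⟶ P ⟶ M ⟶ 0` the injective dimension of `M` is at most one
if those of `K` and `P` are: the bound does not grow along a projective resolution. -/
lemma hasInjectiveDimensionLE_one_of_hasProjectiveDimensionLT [EnoughProjectives A]
    (h : ∀ (P : A) [Projective P], HasInjectiveDimensionLE P 1) (n : ℕ) :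
    ∀ (M : A) [HasProjectiveDimensionLT M n], HasInjectiveDimensionLE M 1 := by
  induction n with
  | zero =>
    intro M _
    have := (isZero_of_hasProjectiveDimensionLT_zero M).hasInjectiveDimensionLT_zero
    exact hasInjectiveDimensionLT_of_ge M 0 2 (by lia)
  | succ n ih =>
    intro M hM
    obtain _ | n := n
    · have := (projective_iff_hasProjectiveDimensionLT_one (X := M)).2 hM
      exact h M
    obtain ⟨P⟩ := EnoughProjectives.presentation M
    have hS : (ShortComplex.mk _ _ (kernel.condition P.f)).ShortExact :=
      { exact := ShortComplex.exact_kernel P.f }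
    have h1 : HasProjectiveDimensionLT (kernel P.f) (n + 1) :=
      hS.hasProjectiveDimensionLT_X₁ (n + 1)
        (hasProjectiveDimensionLT_of_ge P.p 1 (n + 1) (by lia)) hM
    have h2 : HasInjectiveDimensionLT (kernel P.f) 2 := ih _
    exact hS.hasInjectiveDimensionLT_X₃ 2 (h P.p)
      (hasInjectiveDimensionLT_of_ge (kernel P.f) 2 3 (by lia))

lemma hasProjectiveDimensionLE_one_of_hasInjectiveDimensionLT [EnoughInjectives A]
    (h : ∀ (J : A) [Injective J], HasProjectiveDimensionLE J 1) (n : ℕ) :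
    ∀ (M : A) [HasInjectiveDimensionLT M n], HasProjectiveDimensionLE M 1 := by
  induction n with
  | zero =>
    intro M _
    have := (isZero_of_hasInjectiveDimensionLT_zero M).hasProjectiveDimensionLT_zero
    exact hasProjectiveDimensionLT_of_ge M 0 2 (by lia)
  | succ n ih =>
    intro M hM
    obtain _ | n := n
    · have := (injective_iff_hasInjectiveDimensionLT_one (X := M)).2 hM
      exact h M
    obtain ⟨P⟩ := EnoughInjectives.presentation M
    have hS : (ShortComplex.mk _ _ (cokernel.condition P.f)).ShortExact :=
      { exact := ShortComplex.exact_cokernel P.f }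
    have h1 : HasInjectiveDimensionLT (cokernel P.f) (n + 1) :=
      hS.hasInjectiveDimensionLT_X₃ (n + 1)
        (hasInjectiveDimensionLT_of_ge P.J 1 (n + 1) (by lia)) hM
    have h2 : HasProjectiveDimensionLT (cokernel P.f) 2 := ih _
    exact hS.hasProjectiveDimensionLT_X₁ 2 (h P.J)
      (hasProjectiveDimensionLT_of_ge (cokernel P.f) 2 3 (by lia))

lemma isNGorensteinCategory_one [EnoughProjectives A] [EnoughInjectives A]
    (hA : IsGrothendieckAbelian.{v} A)
    (hP : ∀ (P : A) [Projective P], HasInjectiveDimensionLE P 1)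
    (hJ : ∀ (J : A) [Injective J], HasProjectiveDimensionLE J 1)
    (hgen : ∃ G : A, IsSeparator G ∧ Projective G)
    (hpd : ∃ M : A, HasProjectiveDimensionLE M 1 ∧ ¬ Projective M)
    (hid : ∃ M : A, HasInjectiveDimensionLE M 1 ∧ ¬ Injective M) :
    IsNGorensteinCategory A 1 := by
  have key1 (M : A) (h : projectiveDimension M < ⊤) : injectiveDimension M ≤ (1 : ℕ) := by
    obtain ⟨n, hn⟩ := (projectiveDimension_ne_top_iff M).1 h.ne
    exact (injectiveDimension_le_iff M 1).2
      (hasInjectiveDimensionLE_one_of_hasProjectiveDimensionLT hP (n + 1) M)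
  have key2 (M : A) (h : injectiveDimension M < ⊤) : projectiveDimension M ≤ (1 : ℕ) := by
    obtain ⟨n, hn⟩ := (injectiveDimension_ne_top_iff M).1 h.ne
    exact (projectiveDimension_le_iff M 1).2
      (hasProjectiveDimensionLE_one_of_hasInjectiveDimensionLT hJ (n + 1) M)
  have lt_top {d : WithBot ℕ∞} (h : d ≤ (1 : ℕ)) : d < ⊤ := h.trans_lt (by decide)
  have hiff (M : A) : projectiveDimension M < ⊤ ↔ injectiveDimension M < ⊤ :=
    ⟨fun h => lt_top (key1 M h), fun h => lt_top (key2 M h)⟩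
  have hfpd : finitaryProjectiveDimension A = (1 : ℕ) := by
    refine le_antisymm (iSup₂_le fun M hM => key2 M ((hiff M).1 hM)) ?_
    obtain ⟨M, h1, h2⟩ := hpd
    rw [← projectiveDimension_le_iff] at h1
    rw [projective_iff_hasProjectiveDimensionLT_one, ← projectiveDimension_ge_iff] at h2
    exact h2.trans (le_iSup₂_of_le M (lt_top h1) le_rfl)
  have hfid : finitaryInjectiveDimension A = (1 : ℕ) := by
    refine le_antisymm (iSup₂_le fun M hM => key1 M ((hiff M).2 hM)) ?_
    obtain ⟨M, h1, h2⟩ := hid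
    rw [← injectiveDimension_le_iff] at h1
    rw [injective_iff_hasInjectiveDimensionLT_one, ← injectiveDimension_ge_iff] at h2
    exact h2.trans (le_iSup₂_of_le M (lt_top h1) le_rfl)
  obtain ⟨G, hG, hG'⟩ := hgen
  exact
    { isGrothendieck := hA
      projectiveDimension_lt_top_iff := hiff
      finitaryProjectiveDimension_lt_top := lt_top hfpd.le
      finitaryInjectiveDimension_lt_top := lt_top hfid.le
      exists_generator := ⟨G, hG, lt_top <| (projectiveDimension_le_iff G 1).2 <|
        hasProjectiveDimensionLT_of_ge G 1 2 (by lia)⟩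
      finitaryProjectiveDimension_eq := hfpd
      finitaryInjectiveDimension_eq := hfid }

end DimensionOne

/-! ### Frobenius forms and coinduced modules -/

/-- A family of functionals `form X : End X → ℤ` for which the pairings
`C(X, W) × C(W, X) → ℤ`, `(f, g) ↦ form X (f ≫ g)`, are perfect. Perfectness is encoded by dual
generating families: expanding `f : X ⟶ W` in `basis` has the coefficients
`form X (f ≫ dual i)`, and expanding `g : W ⟶ X` in `dual` has the coefficients
`form X (basis i ≫ g)`. Only these two expansions are required; no symmetry relating `form X` and `form W` is. -/
structure FrobeniusForm (C : Type) [SmallCategory C] [Preadditive C] where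
  form (X : C) : (X ⟶ X) →+ ℤ
  Index (X W : C) : Type
  [fintypeIndex (X W : C) : Fintype (Index X W)]
  basis {X W : C} : Index X W → (X ⟶ W)
  dual {X W : C} : Index X W → (W ⟶ X)
  sum_basis {X W : C} (f : X ⟶ W) : ∑ i, form X (f ≫ dual i) • basis i = f
  sum_dual {X W : C} (g : W ⟶ X) : ∑ i, form X (basis i ≫ g) • dual i = g

attribute [instance] FrobeniusForm.fintypeIndex

namespace RightModules

variable {C : Type} [SmallCategory C] [Preadditive C]

/-- An additive map between `ℤ`-modules as a morphism of `ModuleCat ℤ`, whatever the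
`ℤ`-module structures are. -/
def homOfAddMonoidHom {M N : ModuleCat.{0} ℤ} (f : M →+ N) : M ⟶ N :=
  ModuleCat.ofHom
    { toFun := f
      map_add' := f.map_add
      map_smul' n m := by simpa using map_intCast_smul f ℤ ℤ n m }

/-- The additive map `(V ⟶ W) →+ (M W →+ M V)` given by a right module `M`. -/
def action (M : RightModules C) (V W : C) :
    (V ⟶ W) →+ (M.obj.obj (op W) →+ M.obj.obj (op V)) :=
  AddMonoidHom.mk' (fun u => (M.obj.map u.op).hom.toAddMonoidHom) fun u v => by
    ext m
    have h : M.obj.map (u + v).op = M.obj.map u.op + M.obj.map v.op := by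
      rw [op_add, Functor.map_add]
    exact ConcreteCategory.congr_hom h m

lemma action_comp (M : RightModules C) {U V W : C} (u : U ⟶ V) (v : V ⟶ W)
    (m : M.obj.obj (op W)) :
    action M U W (u ≫ v) m = action M U V u (action M V W v m) :=
  ConcreteCategory.congr_hom (M.obj.map_comp v.op u.op) m

lemma action_id (M : RightModules C) (W : C) (m : M.obj.obj (op W)) :
    action M W W (𝟙 W) m = m :=
  ConcreteCategory.congr_hom (M.obj.map_id (op W)) m

/-- The component at `W` of a morphism of right modules. -/
def component {M N : RightModules C} (f : M ⟶ N) (W : C) :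
    M.obj.obj (op W) →+ N.obj.obj (op W) :=
  (f.hom.app (op W)).hom.toAddMonoidHom

lemma component_action {M N : RightModules C} (f : M ⟶ N) {V W : C} (u : V ⟶ W)
    (m : M.obj.obj (op W)) :
    component f V (action M V W u m) = action N V W u (component f W m) :=
  ConcreteCategory.congr_hom (f.hom.naturality u.op) m

lemma hom_ext {M N : RightModules C} {f g : M ⟶ N}
    (h : ∀ (W : C) (m : M.obj.obj (op W)), component f W m = component g W m) : f = g := by
  apply ObjectProperty.hom_ext
  ext W m
  exact h W.unop m

/-- A morphism of right modules from a compatible family of additive maps. -/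
def homMk {M N : RightModules C} (f : ∀ W : C, M.obj.obj (op W) →+ N.obj.obj (op W))
    (hf : ∀ {V W : C} (u : V ⟶ W) (m : M.obj.obj (op W)),
      f V (action M V W u m) = action N V W u (f W m)) : M ⟶ N :=
  ObjectProperty.homMk
    { app W := homOfAddMonoidHom (f W.unop)
      naturality {W V} u := by
        ext m
        exact hf u.unop m }

/-- Evaluation at an object. -/
def eval (X : C) : RightModules C ⥤ ModuleCat.{0} ℤ :=
  AdditiveFunctor.forget _ _ ⋙ (evaluation _ _).obj (op X)

/-- The underlying functor of `coind X`. -/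
def coindFunctor (X : C) (E : ModuleCat.{0} ℤ) : Cᵒᵖ ⥤ ModuleCat.{0} ℤ where
  obj W := ModuleCat.of ℤ ((X ⟶ W.unop) →+ E)
  map {W V} u := homOfAddMonoidHom (M := ModuleCat.of ℤ ((X ⟶ W.unop) →+ E))
    (N := ModuleCat.of ℤ ((X ⟶ V.unop) →+ E))
    (AddMonoidHom.compHom' (Preadditive.rightComp X u.unop))
  map_id W := by
    refine ConcreteCategory.hom_ext _ _ fun h => AddMonoidHom.ext fun f => ?_
    let h' : (X ⟶ W.unop) →+ E := h
    exact congrArg h' (Category.comp_id f)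
  map_comp {U V W} u v := by
    refine ConcreteCategory.hom_ext _ _ fun h => AddMonoidHom.ext fun f => ?_
    let h' : (X ⟶ U.unop) →+ E := h
    exact congrArg h' (Category.assoc f v.unop u.unop).symm

instance (X : C) (E : ModuleCat.{0} ℤ) : (coindFunctor X E).Additive where
  map_add {V W u v} := by
    refine ConcreteCategory.hom_ext _ _ fun h => AddMonoidHom.ext fun f => ?_
    let h' : (X ⟶ V.unop) →+ E := h
    exact (congrArg h' (Preadditive.comp_add _ _ _ f u.unop v.unop)).trans (h'.map_add _ _)

/-- The coinduction functor `E ↦ Hom_ℤ(C(X, -), E)`. -/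
def coind (X : C) : ModuleCat.{0} ℤ ⥤ RightModules C where
  obj E := AdditiveFunctor.of (coindFunctor X E)
  map {E E'} φ := homMk (M := AdditiveFunctor.of (coindFunctor X E))
    (N := AdditiveFunctor.of (coindFunctor X E'))
    (fun _ => AddMonoidHom.compHom φ.hom.toAddMonoidHom) (fun _ _ => rfl)
  map_id _ := rfl
  map_comp _ _ := rfl

/-- An element of `coind X E` at `W`, as an additive map. This identification is definitional; it
serves to apply the elements as functions. -/
def coindEquiv (X : C) (E : ModuleCat.{0} ℤ) (W : C) :
    (((coind X).obj E).obj.obj (op W)) ≃+ ((X ⟶ W) →+ E) := AddEquiv.refl _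

lemma coindEquiv_action (X : C) (E : ModuleCat.{0} ℤ) {V W : C} (u : V ⟶ W)
    (h : ((coind X).obj E).obj.obj (op W)) (f : X ⟶ V) :
    coindEquiv X E V (action _ V W u h) f = coindEquiv X E W h (f ≫ u) := rfl

/-- Evaluation at `X` is left adjoint to `coind X`. -/
def evalAdjCoind (X : C) : eval X ⊣ coind X :=
  Adjunction.mkOfHomEquiv
    { homEquiv M E :=
        { toFun φ := homMk (N := (coind X).obj E)
            (fun W => (AddMonoidHom.compHom φ.hom.toAddMonoidHom).comp (action M X W) |>.flip)
            (fun {V W} u m => AddMonoidHom.ext fun f =>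
              congrArg φ.hom (action_comp M f u m).symm)
          invFun ψ := homOfAddMonoidHom (M := (eval X).obj M)
            ((AddMonoidHom.eval (𝟙 X)).comp (component ψ X))
          left_inv φ := by
            ext m
            exact congrArg φ.hom (action_id M X m)
          right_inv ψ := by
            refine hom_ext fun W m => AddMonoidHom.ext fun f => ?_
            have h := DFunLike.congr_fun
              (congrArg (coindEquiv X E X) (component_action ψ f m)) (𝟙 X)
            exact h.trans (congrArg (coindEquiv X E W (component ψ W m)) (Category.id_comp f)) }
      homEquiv_naturality_left_symm f g := rfl
      homEquiv_naturality_right f g := rfl }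

variable (𝓕 : FrobeniusForm C)

/-- The Casimir tensors `∑ i, basis i ⊗ dual i` are compatible with composition with `u : V ⟶ W`:
both sides expand to the same double sum over `C(X, V)` and `C(X, W)`. -/
lemma sum_action_dual_basis_comp (M : RightModules C) {V W X : C} (u : V ⟶ W)
    (H : (X ⟶ W) →+ M.obj.obj (op X)) :
    ∑ i : 𝓕.Index X V, action M V X (𝓕.dual i) (H (𝓕.basis i ≫ u)) =
      action M V W u (∑ k : 𝓕.Index X W, action M W X (𝓕.dual k) (H (𝓕.basis k))) := by
  have h1 (i : 𝓕.Index X V) : action M V X (𝓕.dual i) (H (𝓕.basis i ≫ u)) =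
      ∑ k : 𝓕.Index X W, 𝓕.form X ((𝓕.basis i ≫ u) ≫ 𝓕.dual k) •
        action M V X (𝓕.dual i) (H (𝓕.basis k)) := by
    conv_lhs => rw [← 𝓕.sum_basis (𝓕.basis i ≫ u)]
    simp only [map_sum, map_zsmul]
  have h2 (k : 𝓕.Index X W) : action M V W u (action M W X (𝓕.dual k) (H (𝓕.basis k))) =
      ∑ i : 𝓕.Index X V, 𝓕.form X ((𝓕.basis i ≫ u) ≫ 𝓕.dual k) •
        action M V X (𝓕.dual i) (H (𝓕.basis k)) := by
    rw [← action_comp]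
    conv_lhs => rw [← 𝓕.sum_dual (u ≫ 𝓕.dual k)]
    simp only [map_sum, map_zsmul, AddMonoidHom.finsetSum_apply, AddMonoidHom.zsmul_apply,
      Category.assoc]
  simp_rw [map_sum, h1, h2]
  exact Finset.sum_comm

/-- The morphism `coind X E ⟶ M` corresponding to a map `φ : E ⟶ M X`: at `W` it sends
`h : C(X, W) → E` to `∑ i, φ (h (basis i)) · dual i`. -/
def homCoind {X : C} {E : ModuleCat.{0} ℤ} {M : RightModules C} (φ : E →+ M.obj.obj (op X)) :
    (coind X).obj E ⟶ M :=
  homMk (M := (coind X).obj E)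
    (fun W => AddMonoidHom.mk' (fun h => ∑ i : 𝓕.Index X W,
        action M W X (𝓕.dual i) (φ (coindEquiv X E W h (𝓕.basis i)))) fun h h' => by
      simp only [map_add, AddMonoidHom.add_apply, Finset.sum_add_distrib])
    (fun {V W} u h => sum_action_dual_basis_comp 𝓕 M u (φ.comp (coindEquiv X E W h)))

lemma component_homCoind {X : C} {E : ModuleCat.{0} ℤ} {M : RightModules C}
    (φ : E →+ M.obj.obj (op X)) (W : C) (h : ((coind X).obj E).obj.obj (op W)) :
    component (homCoind 𝓕 φ) W h =
      ∑ i : 𝓕.Index X W, action M W X (𝓕.dual i) (φ (coindEquiv X E W h (𝓕.basis i))) := rfl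

/-- The map `E → coind X E X` sending `e` to `f ↦ λ(f) e`. -/
def formSmul (X : C) (E : ModuleCat.{0} ℤ) : E →+ ((coind X).obj E).obj.obj (op X) :=
  (coindEquiv X E X).symm.toAddMonoidHom.comp (AddMonoidHom.mk' (fun e =>
    AddMonoidHom.mk' (fun f => 𝓕.form X f • e) fun f g => by rw [map_add, add_zsmul])
    fun e e' => AddMonoidHom.ext fun f => zsmul_add _ _ _)

lemma coindEquiv_formSmul (X : C) (E : ModuleCat.{0} ℤ) (e : E) (f : X ⟶ X) :
    coindEquiv X E X (formSmul 𝓕 X E e) f = 𝓕.form X f • e := rfl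

lemma homCoind_formSmul {X : C} {E : ModuleCat.{0} ℤ} {M : RightModules C}
    (φ : E →+ M.obj.obj (op X)) (e : E) :
    component (homCoind 𝓕 φ) X (formSmul 𝓕 X E e) = φ e := by
  rw [component_homCoind]
  have h := 𝓕.sum_dual (𝟙 X)
  simp only [Category.comp_id] at h
  conv_rhs => rw [← action_id M X (φ e), ← h]
  simp only [coindEquiv_formSmul, map_zsmul, map_sum, AddMonoidHom.finsetSum_apply,
    AddMonoidHom.zsmul_apply]

lemma sum_action_formSmul {X W : C} {E : ModuleCat.{0} ℤ}
    (h : ((coind X).obj E).obj.obj (op W)) :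
    ∑ i : 𝓕.Index X W, action ((coind X).obj E) W X (𝓕.dual i)
      (formSmul 𝓕 X E (coindEquiv X E W h (𝓕.basis i))) = h := by
  apply (coindEquiv X E W).injective
  refine AddMonoidHom.ext fun f => ?_
  rw [map_sum, AddMonoidHom.finsetSum_apply]
  simp_rw [coindEquiv_action, coindEquiv_formSmul, ← map_zsmul, ← map_sum, 𝓕.sum_basis]

/-- Over a Frobenius category, coinduction from `X` is also left adjoint to evaluation at `X`. -/
def coindAdjEval (X : C) : coind X ⊣ eval X :=
  Adjunction.mkOfHomEquiv
    { homEquiv E M :=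
        { toFun ψ := homOfAddMonoidHom (N := (eval X).obj M)
            ((component ψ X).comp (formSmul 𝓕 X E))
          invFun φ := homCoind 𝓕 φ.hom.toAddMonoidHom
          left_inv ψ := by
            refine hom_ext fun W h => ?_
            conv_rhs => rw [← sum_action_formSmul 𝓕 h, map_sum]
            simp_rw [component_action]
            rfl
          right_inv φ := by
            refine ConcreteCategory.hom_ext _ _ fun e => ?_
            exact homCoind_formSmul 𝓕 φ.hom.toAddMonoidHom e }
      homEquiv_naturality_left_symm f g := hom_ext fun W h => rfl
      homEquiv_naturality_right f g := rfl }

end RightModules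

/-! ### Modules form a Grothendieck category -/

section Grothendieck

variable {C : Type u₁} [Category.{v₁} C] [Preadditive C]
  {D : Type u₂} [Category.{v₂} D] [Abelian D]

instance additiveFunctor_isClosedUnderColimitsOfShape (J : Type u) [Category.{v} J]
    [HasColimitsOfShape J D] : (additiveFunctor C D).IsClosedUnderColimitsOfShape J where
  colimitsOfShape_le := by
    rintro F ⟨p⟩
    refine (additiveFunctor_iff F).2 ⟨fun {X Y f g} => ?_⟩
    refine (isColimitOfPreserves ((evaluation C D).obj X) p.isColimit).hom_ext fun j => ?_
    have hj : (p.diag.obj j).Additive := p.prop_diag_obj j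
    have h : ∀ k : X ⟶ Y, (p.ι.app j).app X ≫ F.map k = _ :=
      fun k => ((p.ι.app j).naturality k).symm
    change (p.ι.app j).app X ≫ F.map (f + g) = (p.ι.app j).app X ≫ (F.map f + F.map g)
    rw [Preadditive.comp_add, h, h, h, Functor.map_add, Preadditive.add_comp]

instance additiveFunctor_isClosedUnderLimitsOfShape (J : Type u) [Category.{v} J]
    [HasLimitsOfShape J D] : (additiveFunctor C D).IsClosedUnderLimitsOfShape J where
  limitsOfShape_le := by
    rintro F ⟨p⟩
    refine (additiveFunctor_iff F).2 ⟨fun {X Y f g} => ?_⟩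
    refine (isLimitOfPreserves ((evaluation C D).obj Y) p.isLimit).hom_ext fun j => ?_
    have hj : (p.diag.obj j).Additive := p.prop_diag_obj j
    have h := fun (k : X ⟶ Y) => (p.π.app j).naturality k
    simp only [Functor.const_obj_obj] at h
    simp [Preadditive.add_comp, Preadditive.comp_add, h]

lemma isGrothendieckAbelian_rightModules (C : Type) [SmallCategory C] [Preadditive C]
    (hs : HasSeparator (RightModules C)) : IsGrothendieckAbelian.{0} (RightModules C) where
  hasFilteredColimitsOfSize := ⟨fun J _ _ => inferInstance⟩
  ab5OfSize :=
    have : HasFilteredColimitsOfSize.{0, 0} (RightModules C) := ⟨fun J _ _ => inferInstance⟩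
    ⟨fun J _ _ => by
      have : PreservesFiniteLimits (AdditiveFunctor.forget Cᵒᵖ (ModuleCat.{0} ℤ)) :=
        ⟨fun K _ _ => inferInstance⟩
      have : ReflectsFiniteLimits (AdditiveFunctor.forget Cᵒᵖ (ModuleCat.{0} ℤ)) :=
        ⟨fun K _ _ => inferInstance⟩
      exact HasExactColimitsOfShape.domain_of_functor J
        (AdditiveFunctor.forget Cᵒᵖ (ModuleCat.{0} ℤ))⟩

end Grothendieck

/-! ### Categories with a Frobenius form are Gorenstein of dimension one -/

namespace RightModules

variable {C : Type} [SmallCategory C] [Preadditive C]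

lemma eq_zero_of_eval_map_eq_zero {M N : RightModules C} (f : M ⟶ N)
    (h : ∀ X, (eval X).map f = 0) : f = 0 :=
  hom_ext fun W m => ConcreteCategory.congr_hom (h W) m

variable (𝓕 : FrobeniusForm C)
include 𝓕

lemma projective_coind_int (X : C) : Projective ((coind X).obj (ModuleCat.of ℤ ℤ)) := by
  have := (evalAdjCoind X).leftAdjoint_preservesColimits
  have : Projective (ModuleCat.of ℤ ℤ) := (IsProjective.iff_projective ℤ).1 inferInstance
  exact (coindAdjEval 𝓕 X).map_projective _ inferInstance

lemma isSeparator_biproduct_coind_int [Finite C] :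
    IsSeparator (⨁ fun X : C => (coind X).obj (ModuleCat.of ℤ ℤ)) := by
  rw [Preadditive.isSeparator_iff]
  intro M N f hf
  refine hom_ext fun X m => ?_
  let φ : ModuleCat.of ℤ ℤ →+ M.obj.obj (op X) := zmultiplesHom _ m
  have h : homCoind 𝓕 φ ≫ f = 0 := by
    have := biproduct.ι (fun X : C => (coind X).obj (ModuleCat.of ℤ ℤ)) X ≫=
      hf (biproduct.π (fun X : C => (coind X).obj (ModuleCat.of ℤ ℤ)) X ≫ homCoind 𝓕 φ)
    simpa using this
  have h1 := homCoind_formSmul 𝓕 φ (1 : ℤ)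
  have h2 : φ (1 : ℤ) = m := one_zsmul m
  rw [← h2, ← h1]
  exact congrArg (fun k => component k X (formSmul 𝓕 X (ModuleCat.of ℤ ℤ) (1 : ℤ))) h

/-- A section of the reduction `coind X ℤ ⟶ coind X (ℤ / 2)` would send the `2`-torsion element
`formSmul 1` to zero, as `coind X ℤ` is torsion free. -/
lemma not_projective_coind_zmod_two (X : C) (e : X ⟶ X) (he : 𝓕.form X e = 1) :
    ¬ Projective ((coind X).obj (ModuleCat.of ℤ (ZMod 2))) := by
  intro hP
  let q : ModuleCat.of ℤ ℤ ⟶ ModuleCat.of ℤ (ZMod 2) :=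
    ModuleCat.ofHom (Int.castAddHom (ZMod 2)).toIntLinearMap
  have hq : Epi q := (ModuleCat.epi_iff_surjective q).2 (ZMod.intCast_surjective (n := 2))
  have := (coindAdjEval 𝓕 X).leftAdjoint_preservesColimits
  let s := Projective.factorThru (𝟙 _) ((coind X).map q)
  let z := formSmul 𝓕 X (ModuleCat.of ℤ (ZMod 2)) (1 : ZMod 2)
  have hz : component ((coind X).map q) X (component s X z) = z :=
    congrArg (fun k => component k X z)
      (Projective.factorThru_comp (𝟙 _) ((coind X).map q))
  have h2z : (2 : ℤ) • z = 0 := by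
    rw [← map_zsmul]
    exact map_zero _
  have h0 : component s X z = 0 := by
    have h : (2 : ℤ) • component s X z = 0 := by rw [← map_zsmul, h2z, map_zero]
    refine AddMonoidHom.ext (M := X ⟶ X) (N := ℤ) fun f => ?_
    have h' : (2 : ℤ) • (coindEquiv X (ModuleCat.of ℤ ℤ) X (component s X z) f : ℤ) = 0 :=
      DFunLike.congr_fun (congrArg (coindEquiv X (ModuleCat.of ℤ ℤ) X) h) f
    exact (smul_eq_zero.1 h').resolve_left two_ne_zero
  rw [h0, map_zero] at hz
  have h1 : (0 : ZMod 2) = (𝓕.form X e) • (1 : ZMod 2) :=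
    DFunLike.congr_fun (congrArg (coindEquiv X (ModuleCat.of ℤ (ZMod 2)) X) hz) e
  rw [he] at h1
  revert h1
  decide

/-- A retraction of multiplication by `2` on `coind X ℤ` would make `form X` divisible by `2`. -/
lemma not_injective_coind_int (X : C) (e : X ⟶ X) (he : 𝓕.form X e = 1) :
    ¬ Injective ((coind X).obj (ModuleCat.of ℤ ℤ)) := by
  intro hJ
  let q : ModuleCat.of ℤ ℤ ⟶ ModuleCat.of ℤ ℤ :=
    ModuleCat.ofHom (AddMonoidHom.mulLeft (2 : ℤ)).toIntLinearMap
  have hq : Mono q := (ModuleCat.mono_iff_injective q).2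
    (mul_right_injective₀ (two_ne_zero' ℤ))
  have := (evalAdjCoind X).rightAdjoint_preservesLimits
  let r := Injective.factorThru (𝟙 _) ((coind X).map q)
  let z := formSmul 𝓕 X (ModuleCat.of ℤ ℤ) (1 : ℤ)
  have hz : component r X (component ((coind X).map q) X z) = z :=
    congrArg (fun k => component k X z) (Injective.comp_factorThru (𝟙 _) ((coind X).map q))
  have h2z : component ((coind X).map q) X z = (2 : ℤ) • z := rfl
  rw [h2z, map_zsmul] at hz
  have h : (2 : ℤ) * (coindEquiv X (ModuleCat.of ℤ ℤ) X (component r X z) e : ℤ) =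
      𝓕.form X e * 1 :=
    DFunLike.congr_fun (congrArg (coindEquiv X (ModuleCat.of ℤ ℤ) X) hz) e
  rw [he] at h
  lia

end RightModules

open RightModules in
/-- The functional `form X` has to take the value `1` for some `X`, since otherwise `C` may be the
zero category, whose module category has Gorenstein dimension `⊥`. -/
theorem FrobeniusForm.isNGorenstein_one {C : Type} [SmallCategory C] [Preadditive C] [Finite C]
    (𝓕 : FrobeniusForm C) (X : C) (e : X ⟶ X) (he : 𝓕.form X e = 1) : IsNGorenstein C 1 := by
  have hB := ModuleCat.hasInjectiveDimensionLE_one_of_isPrincipalIdealRing (R := ℤ)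
  have := enoughProjectives_of_adjunctions (coindAdjEval 𝓕) evalAdjCoind
    eq_zero_of_eval_map_eq_zero
  have := enoughInjectives_of_adjunctions (coindAdjEval 𝓕) evalAdjCoind
    eq_zero_of_eval_map_eq_zero
  have hsep := isSeparator_biproduct_coind_int 𝓕
  refine isNGorensteinCategory_one (isGrothendieckAbelian_rightModules C ⟨_, hsep⟩)
    (fun P _ => hasInjectiveDimensionLE_one_of_projective (coindAdjEval 𝓕) evalAdjCoind
      eq_zero_of_eval_map_eq_zero hB P)
    (fun J _ => hasProjectiveDimensionLE_one_of_injective (coindAdjEval 𝓕) evalAdjCoind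
      eq_zero_of_eval_map_eq_zero hB J)
    ⟨_, hsep, ?_⟩
    ⟨_, hasProjectiveDimensionLE_one_of_adjunctions (coindAdjEval 𝓕 X) (evalAdjCoind X) hB _,
      not_projective_coind_zmod_two 𝓕 X e he⟩
    ⟨_, hasInjectiveDimensionLE_one_of_adjunctions (coindAdjEval 𝓕 X) (evalAdjCoind X) hB _,
      not_injective_coind_int 𝓕 X e he⟩
  exact projective_iff_hasProjectiveDimensionLT_one.2 <|
    hasProjectiveDimensionLT_biproduct _ 1 fun X =>
      projective_iff_hasProjectiveDimensionLT_one.1 (projective_coind_int 𝓕 X)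

/-! ### The polynomial `N (1 - x)` -/

section NormPolynomial

/-- The coefficient of `x ^ k` in `N (1 - x)`. -/
def normCoeff (p k : ℕ) : ℤ := (-1) ^ k * (p.choose (k + 1) : ℤ)

lemma normCoeff_zero (p : ℕ) : normCoeff p 0 = p := by simp [normCoeff]

lemma isUnit_normCoeff_sub_one {p : ℕ} (hp : 0 < p) : IsUnit (normCoeff p (p - 1)) := by
  rw [normCoeff, Nat.sub_add_cancel hp, Nat.choose_self, Nat.cast_one, mul_one]
  exact isUnit_one.neg.pow _

lemma sum_one_sub_pow {R : Type*} [Ring R] (x : R) (p : ℕ) :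
    ∑ i ∈ Finset.range p, (1 - x) ^ i = ∑ k ∈ Finset.range p, normCoeff p k • x ^ k := by
  induction p with
  | zero => simp
  | succ p ih =>
    have h : (1 - x) ^ p = ∑ k ∈ Finset.range (p + 1), ((-1) ^ k * (p.choose k : ℤ)) • x ^ k := by
      rw [sub_eq_neg_add, (Commute.one_right (-x)).add_pow]
      refine Finset.sum_congr rfl fun k _ => ?_
      rw [neg_pow, one_pow, mul_one, zsmul_eq_mul]
      push_cast
      rw [mul_assoc, mul_assoc, (Nat.cast_commute _ _).eq]
    have h' : ∑ k ∈ Finset.range p, normCoeff p k • x ^ k =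
        ∑ k ∈ Finset.range (p + 1), normCoeff p k • x ^ k := by
      rw [Finset.sum_range_succ, normCoeff, Nat.choose_succ_self]
      simp
    rw [Finset.sum_range_succ, ih, h, h', ← Finset.sum_add_distrib]
    refine Finset.sum_congr rfl fun k _ => ?_
    rw [← add_smul, normCoeff, normCoeff, Nat.choose_succ_succ']
    push_cast
    ring_nf

/-- As the top coefficient of `N (1 - x)` is invertible, a relation with these coefficients
expresses its last term through the others. -/
lemma mem_of_sum_normCoeff_mem {G : Type*} [AddCommGroup G] (S : Submodule ℤ G) {p : ℕ}
    (hp : 0 < p) (φ : ℕ → G) (h : ∑ k ∈ Finset.range p, normCoeff p k • φ k ∈ S)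
    (hφ : ∀ k < p - 1, φ k ∈ S) : φ (p - 1) ∈ S := by
  obtain ⟨p, rfl⟩ : ∃ q, p = q + 1 := ⟨p - 1, by lia⟩
  rw [Finset.sum_range_succ, add_mem_cancel_left
    (S.sum_mem fun k hk => S.smul_mem _ (hφ k (by simpa using hk)))] at h
  exact (Submodule.smul_mem_iff_of_isUnit S (isUnit_normCoeff_sub_one hp)).1 h

open Polynomial in
/-- The ring `K` is `ℚ[x] / N (1 - x)`, where `1, x, ..., x ^ (p - 2)` is a basis. The values of `μ`
on `1` and on `x ^ (p - 1)` are tied together by the relation `N (1 - x) = 0`. -/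
lemma exists_normCoeff_functional (p : ℕ) (hp : 2 ≤ p) :
    ∃ (K : Type) (_ : CommRing K) (x : K) (μ : K →+ ℚ), ∑ i ∈ Finset.range p, (1 - x) ^ i = 0 ∧
      (∀ k, 1 ≤ k → k < p - 1 → μ (x ^ k) = 0) ∧ μ (x ^ (p - 1)) = 1 ∧
      p * μ 1 = - normCoeff p (p - 1) := by
  obtain ⟨n, rfl⟩ : ∃ n, p = n + 2 := ⟨p - 2, by lia⟩
  rw [show n + 2 - 1 = n + 1 by lia]
  set c := normCoeff (n + 2) with hc
  have hu : c (n + 1) * c (n + 1) = 1 := by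
    obtain h | h := Int.isUnit_iff.1 (isUnit_normCoeff_sub_one (p := n + 2) (by lia)) <;>
    · have h' : c (n + 1) = _ := h
      rw [h']; rfl
  -- `X ^ (n + 1) + q` is the monic multiple of `N (1 - X)`, as `c (n + 1) = ±1`
  let q : ℚ[X] := ∑ k ∈ Finset.range (n + 1), C ((c (n + 1) * c k : ℤ) : ℚ) * X ^ k
  have hq : q.degree < ((n + 1 : ℕ) : WithBot ℕ) := by
    refine (degree_sum_le _ _).trans_lt ((Finset.sup_lt_iff (by simp)).2 fun k hk => ?_)
    refine (degree_C_mul_X_pow_le _ _).trans_lt ?_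
    exact_mod_cast Finset.mem_range.1 hk
  let g : ℚ[X] := X ^ (n + 1) + q
  have hg : g.Monic := monic_X_pow_add hq
  have hgd : g.natDegree = n + 1 := by
    rw [natDegree_eq_of_degree_eq (degree_add_eq_left_of_degree_lt (by simpa using hq))]
    simp
  have hroot : ∑ k ∈ Finset.range (n + 2), c k • (AdjoinRoot.root g) ^ k = 0 := by
    have h1 : AdjoinRoot.mk g g = 0 := AdjoinRoot.mk_self
    have h2 : c (n + 1) • (AdjoinRoot.mk g g) = ∑ k ∈ Finset.range (n + 2),
        c k • (AdjoinRoot.root g) ^ k := by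
      rw [Finset.sum_range_succ]
      conv_lhs => enter [2, 2]; change X ^ (n + 1) + q
      rw [map_add, smul_add, add_comm, map_sum, Finset.smul_sum]
      congr 1
      · refine Finset.sum_congr rfl fun k _ => ?_
        rw [map_mul, map_pow, AdjoinRoot.mk_X, zsmul_eq_mul, zsmul_eq_mul, ← mul_assoc]
        congr 1
        push_cast
        rw [map_mul, map_mul, ← mul_assoc]
        simp only [map_intCast, ← Int.cast_mul, hu]
        simp
    rw [← h2, h1, smul_zero]
  let pb := AdjoinRoot.powerBasis' hg
  have hdim : pb.dim = n + 1 := hgd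
  let μ : AdjoinRoot g →ₗ[ℚ] ℚ :=
    pb.basis.constr ℚ fun i => if (i : ℕ) = 0 then -(c (n + 1) : ℚ) / (n + 2 : ℕ) else 0
  have hμ (k : ℕ) (hk : k < n + 1) : μ (AdjoinRoot.root g ^ k) =
      if k = 0 then -(c (n + 1) : ℚ) / (n + 2 : ℕ) else 0 := by
    have := pb.basis.constr_basis ℚ
      (fun i => if (i : ℕ) = 0 then -(c (n + 1) : ℚ) / (n + 2 : ℕ) else 0) ⟨k, hdim ▸ hk⟩
    rw [pb.coe_basis] at this
    exact this
  have h1 : ((n + 2 : ℕ) : ℚ) * μ 1 = - c (n + 1) := by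
    have := hμ 0 (by lia)
    rw [pow_zero] at this
    rw [this, if_pos rfl]
    field_simp
  refine ⟨AdjoinRoot g, inferInstance, AdjoinRoot.root g, μ.toAddMonoidHom, ?_, ?_, ?_, h1⟩
  · rw [sum_one_sub_pow]
    exact hroot
  · intro k hk hk'
    exact (hμ k hk').trans (if_neg (by lia))
  · have h2 := congrArg μ hroot
    rw [map_sum, map_zero, Finset.sum_range_succ, Finset.sum_range_succ'] at h2
    rw [Finset.sum_eq_zero fun k hk => ?_, zero_add, pow_zero, map_zsmul, map_zsmul, hc,
      normCoeff_zero, ← hc, zsmul_eq_mul, zsmul_eq_mul] at h2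
    · have h3 : (c (n + 1) : ℚ) ≠ 0 := by
        intro h
        rw [Int.cast_eq_zero] at h
        rw [h] at hu
        simp at hu
      apply mul_left_cancel₀ h3
      push_cast at h2 h1
      change _ * μ (AdjoinRoot.root g ^ (n + 1)) = _
      linarith
    · rw [map_zsmul, hμ _ (by simpa using hk), if_neg (by lia), smul_zero]

end NormPolynomial

/-! ### Invertible Gram matrices -/

section Gram

/-- A Hankel matrix with zeros above its antidiagonal and units on it is invertible. -/
lemma isUnit_det_hankel (n c : ℕ) (ν : ℕ → ℤ) (h0 : ∀ k, c ≤ k → k + 1 < n + c → ν k = 0)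
    (h1 : ∀ k, k + 1 = n + c → IsUnit (ν k)) :
    IsUnit (Matrix.of fun i j : Fin n => ν (i + j + c)).det := by
  -- reversing the columns gives a lower triangular matrix
  let M : Matrix (Fin n) (Fin n) ℤ := Matrix.of fun i j : Fin n => ν (i + j + c)
  have hM : IsUnit (M.submatrix id Fin.revPerm).det := by
    rw [Matrix.det_of_isLowerTriangular]
    · refine IsUnit.prod_univ_iff.2 fun i => h1 _ ?_
      simp only [id, Fin.revPerm_apply, Fin.val_rev]
      lia
    · intro i j hij
      have : (i : ℕ) < j := hij
      refine h0 _ (by lia) ?_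
      simp only [id, Fin.revPerm_apply, Fin.val_rev]
      lia
  rw [Matrix.det_permute'] at hM
  exact isUnit_of_mul_isUnit_right hM

variable {C : Type} [SmallCategory C] [Preadditive C]

/-- Spanning families of `C(X, W)` and `C(W, X)` with an invertible Gram matrix give dual bases. -/
def FrobeniusForm.ofGram (form : ∀ X : C, (X ⟶ X) →+ ℤ) (Index : C → C → Type)
    [∀ X W, Fintype (Index X W)] [∀ X W, DecidableEq (Index X W)]
    (b : ∀ {X W : C}, Index X W → (X ⟶ W)) (c : ∀ {X W : C}, Index X W → (W ⟶ X))
    (hb : ∀ X W : C, Submodule.span ℤ (Set.range (b (X := X) (W := W))) = ⊤)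
    (hc : ∀ X W : C, Submodule.span ℤ (Set.range (c (X := X) (W := W))) = ⊤)
    (hdet : ∀ X W : C, IsUnit (Matrix.of fun i j : Index X W => form X (b i ≫ c j)).det) :
    FrobeniusForm C where
  form := form
  Index := Index
  basis := b
  dual {X W} i :=
    ∑ j, (Matrix.of fun i j : Index X W => form X (b i ≫ c j))⁻¹ j i • c j
  sum_basis {X W} f := by
    set G := Matrix.of fun i j : Index X W => form X (b i ≫ c j) with hG
    have hf : f ∈ Submodule.span ℤ (Set.range (b (X := X) (W := W))) := hb X W ▸ trivial
    obtain ⟨a, rfl⟩ := (Submodule.mem_span_range_iff_exists_fun ℤ).1 hf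
    refine Finset.sum_congr rfl fun i _ => ?_
    congr 1
    have h (k : Index X W) : ∑ j, G⁻¹ j i * G k j = if k = i then 1 else 0 := by
      rw [← Matrix.one_apply, ← Matrix.mul_nonsing_inv G (hdet X W), Matrix.mul_apply]
      exact Finset.sum_congr rfl fun j _ => mul_comm _ _
    simp only [Preadditive.sum_comp, Preadditive.comp_sum, Preadditive.zsmul_comp,
      Preadditive.comp_zsmul, map_sum, map_zsmul, smul_eq_mul]
    have h' (j k : Index X W) : form X (b k ≫ c j) = G k j := rfl
    have h'' : ∑ k, a k * ∑ j, G⁻¹ j i * G k j = a i := by simp [h]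
    rw [← h'']
    simp only [h', Finset.mul_sum]
    rw [Finset.sum_comm]
    refine Finset.sum_congr rfl fun k _ => Finset.sum_congr rfl fun j _ => ?_
    ring
  sum_dual {X W} g := by
    set G := Matrix.of fun i j : Index X W => form X (b i ≫ c j) with hG
    have hg : g ∈ Submodule.span ℤ (Set.range (c (X := X) (W := W))) := hc X W ▸ trivial
    obtain ⟨a, rfl⟩ := (Submodule.mem_span_range_iff_exists_fun ℤ).1 hg
    have h (j k : Index X W) : ∑ i, G⁻¹ j i * G i k = if j = k then 1 else 0 := by
      rw [← Matrix.one_apply, ← Matrix.nonsing_inv_mul G (hdet X W), Matrix.mul_apply]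
    have h' (j k : Index X W) : form X (b k ≫ c j) = G k j := rfl
    simp only [Preadditive.comp_sum, Preadditive.comp_zsmul, map_sum, map_zsmul, smul_eq_mul, h',
      Finset.smul_sum, smul_smul]
    rw [Finset.sum_comm]
    refine Finset.sum_congr rfl fun j _ => ?_
    rw [← Finset.sum_smul]
    congr 1
    simp_rw [Finset.sum_mul]
    rw [Finset.sum_comm]
    simp_rw [mul_assoc, mul_comm (G _ _), ← Finset.mul_sum, h]
    simp

end Gram

section Determinants

variable {ι : Type*} [Fintype ι] [DecidableEq ι] {P : Prop}

lemma isUnit_det_prod_plift [Fintype (ι × PLift P)] [DecidableEq (ι × PLift P)]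
    (M : Matrix (ι × PLift P) (ι × PLift P) ℤ)
    (h : ∀ hP : P, IsUnit (Matrix.of fun i j => M (i, ⟨hP⟩) (j, ⟨hP⟩)).det) : IsUnit M.det := by
  by_cases hP : P
  · let e : ι ≃ ι × PLift P := ⟨fun i => (i, ⟨hP⟩), Prod.fst, fun _ => rfl, fun _ => rfl⟩
    rw [← Matrix.det_submatrix_equiv_self e M]
    exact h hP
  · have : IsEmpty (ι × PLift P) := ⟨fun i => hP i.2.down⟩
    rw [Matrix.det_isEmpty]
    exact isUnit_one

lemma isUnit_det_plift [Fintype (PLift P)] [DecidableEq (PLift P)]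
    (M : Matrix (PLift P) (PLift P) ℤ) (h : ∀ hP : P, IsUnit (M ⟨hP⟩ ⟨hP⟩)) : IsUnit M.det := by
  by_cases hP : P
  · rw [Matrix.det_eq_elem_of_subsingleton M ⟨hP⟩]
    exact h hP
  · have : IsEmpty (PLift P) := ⟨fun i => hP i.down⟩
    rw [Matrix.det_isEmpty]
    exact isUnit_one

lemma isUnit_det_sum {κ : Type*} [Fintype κ] [DecidableEq κ] (M : Matrix (ι ⊕ κ) (ι ⊕ κ) ℤ)
    (h₁₂ : M.toBlocks₁₂ = 0) (h₁ : IsUnit M.toBlocks₁₁.det) (h₂ : IsUnit M.toBlocks₂₂.det) :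
    IsUnit M.det := by
  rw [← Matrix.fromBlocks_toBlocks M, h₁₂, Matrix.det_fromBlocks_zero₁₂]
  exact h₁.mul h₂

end Determinants

namespace KohlerCategory

/-! ### Generators and relations of Köhler's category -/

section Presentation

variable (p : ℕ)

/-- The projection from the free `ℤ`-linear category. -/
abbrev proj : KohlerFree ⥤ KohlerCategory p := CategoryTheory.Quotient.functor _

instance : (proj p).Additive :=
  CategoryTheory.Quotient.functor_additive (AdditiveCongruence (KohlerRel p))
    fun _ _ _ _ _ _ h₁ h₂ => .add h₁ h₂

/-- An object of the quiver as an object of Köhler's category. -/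
abbrev ob (X : KohlerObj) : KohlerCategory p := (proj p).obj (kohlerOb X)

/-- An arrow of the quiver as a morphism of Köhler's category. -/
def gen {X Y : KohlerObj} (a : KohlerArrow X Y) : ob p X ⟶ ob p Y := (proj p).map (kohlerGen a)

lemma sound {X Y : KohlerFree} {f g : X ⟶ Y} (h : KohlerRel p f g) :
    (proj p).map f = (proj p).map g :=
  CategoryTheory.Quotient.sound _ (.of h)

lemma map_normSum {X : KohlerFree} (x : X ⟶ X) :
    (proj p).map (normSum p x) = normSum p ((proj p).map x) := by
  rw [normSum, normSum, Functor.map_sum]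
  exact Finset.sum_congr rfl fun i _ => map_pow ((proj p).mapEnd X) (show End X from x) i

/-- A family of subgroups of `C(X, -)` containing `𝟙 X` and stable under composition with the
generating arrows is everything. -/
lemma mem_of_comp_gen_mem {X : KohlerObj} (S : ∀ Y : KohlerObj, Submodule ℤ (ob p X ⟶ ob p Y))
    (hid : 𝟙 (ob p X) ∈ S X)
    (hcomp : ∀ {Y Z : KohlerObj} (a : KohlerArrow Y Z), ∀ f ∈ S Y, f ≫ gen p a ∈ S Z)
    {Y : KohlerObj} (f : ob p X ⟶ ob p Y) : f ∈ S Y := by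
  have hw : ∀ {Y : Paths KohlerObj} (w : (Paths.of KohlerObj).obj X ⟶ Y),
      (proj p).map ((Free.embedding ℤ (Paths KohlerObj)).map w) ∈ S Y := by
    apply Paths.induction_fixed_source
    · exact (congrArg (· ∈ S X) ((proj p).map_id (kohlerOb X))).mpr hid
    · intro Y Z w a h
      refine (congrArg (· ∈ S Z) ?_).mpr (hcomp a _ h)
      exact (congrArg (proj p).map (Functor.map_comp _ _ _)).trans ((proj p).map_comp _ _)
  obtain ⟨f, rfl⟩ := (proj p).map_surjective f
  induction f using Finsupp.induction_linear with
  | zero => exact (S Y).zero_mem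
  | add f g hf hg => exact (S Y).add_mem hf hg
  | single w n =>
    have h1 : (proj p).map (Finsupp.single w n : kohlerOb X ⟶ kohlerOb Y) =
        n • (proj p).map ((Free.embedding ℤ (Paths KohlerObj)).map w) :=
      (congrArg (proj p).map (Finsupp.smul_single_one w n).symm).trans
        ((proj p).map_zsmul (X := kohlerOb X) (Y := kohlerOb Y) (r := n))
    rw [h1]
    exact (S Y).smul_mem n (hw w)

section Relations

variable (ε : Bool)

/-- The arrow `A₀ ⟶ A₁`; `aji` is the generating arrow from index `i` to index `j`. -/
abbrev a10 : ob p (A₀ ε) ⟶ ob p (A₁ ε) := gen p (.α₁₀ ε)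
/-- The arrow `A₀ ⟶ A₂`. -/
abbrev a20 : ob p (A₀ ε) ⟶ ob p (A₂ ε) := gen p (.α₂₀ ε)
/-- The arrow `A₁ ⟶ A₀`. -/
abbrev a01 : ob p (A₁ ε) ⟶ ob p (A₀ ε) := gen p (.α₀₁ ε)
/-- The arrow `ΣA₁ ⟶ A₂`. -/
abbrev a21 : ob p (A₁ !ε) ⟶ ob p (A₂ ε) := gen p (.α₂₁ ε)
/-- The arrow `A₂ ⟶ A₀`. -/
abbrev a02 : ob p (A₂ ε) ⟶ ob p (A₀ ε) := gen p (.α₀₂ ε)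
/-- The arrow `A₂ ⟶ ΣA₁`. -/
abbrev a12 : ob p (A₂ ε) ⟶ ob p (A₁ !ε) := gen p (.α₁₂ ε)

/-- The loop `1 - t₀` on `A₀`. -/
def x0 : ob p (A₀ ε) ⟶ ob p (A₀ ε) := 𝟙 _ - gen p (.t₀ ε)
/-- The loop `1 - s₁` on `A₁`. -/
def y1 : ob p (A₁ ε) ⟶ ob p (A₁ ε) := 𝟙 _ - gen p (.s₁ ε)
/-- The loop `1 - t₂` on `A₂`. -/
def x2 : ob p (A₂ ε) ⟶ ob p (A₂ ε) := 𝟙 _ - gen p (.t₂ ε)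
/-- The loop `1 - s₂` on `A₂`. -/
def y2 : ob p (A₂ ε) ⟶ ob p (A₂ ε) := 𝟙 _ - gen p (.s₂ ε)

lemma gen_t₀ : gen p (.t₀ ε) = 𝟙 _ - x0 p ε := (sub_sub_cancel _ _).symm
lemma gen_s₁ : gen p (.s₁ ε) = 𝟙 _ - y1 p ε := (sub_sub_cancel _ _).symm
lemma gen_t₂ : gen p (.t₂ ε) = 𝟙 _ - x2 p ε := (sub_sub_cancel _ _).symm
lemma gen_s₂ : gen p (.s₂ ε) = 𝟙 _ - y2 p ε := (sub_sub_cancel _ _).symm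

lemma a10_a21 : a10 p (!ε) ≫ a21 p ε = 0 := sound p (.rho1a ε)
lemma a12_a01 : a12 p ε ≫ a01 p (!ε) = 0 := sound p (.rho1b ε)
lemma a21_a02 : a21 p ε ≫ a02 p ε = 0 := sound p (.rho1c ε)
lemma a20_a12 : a20 p ε ≫ a12 p ε = 0 := sound p (.rho1d ε)
lemma a02_a10 : a02 p ε ≫ a10 p ε = 0 := sound p (.rho1e ε)
lemma a01_a20 : a01 p ε ≫ a20 p ε = 0 := sound p (.rho1f ε)

lemma a20_a02 : a20 p ε ≫ a02 p ε = x0 p ε :=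
  (sound p (.rho3a ε)).trans ((proj p).map_sub)
lemma a02_a20 : a02 p ε ≫ a20 p ε = x2 p ε :=
  (sound p (.rho3b ε)).trans ((proj p).map_sub)
lemma a21_a12 : a21 p ε ≫ a12 p ε = y1 p (!ε) :=
  (sound p (.rho4a ε)).trans ((proj p).map_sub)
lemma a12_a21 : a12 p ε ≫ a21 p ε = y2 p ε :=
  (sound p (.rho4b ε)).trans ((proj p).map_sub)

variable {p} in
/-- The power `x ^ n` in the monoid `End X`, as a morphism. -/
def loopPow {X : KohlerCategory p} (x : X ⟶ X) (n : ℕ) : X ⟶ X := ((show End X from x) ^ n : End X)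

section
variable {p} {X Y : KohlerCategory p} (x : X ⟶ X)

@[simp] lemma loopPow_zero : loopPow x 0 = 𝟙 X := pow_zero (M := End X) _
lemma loopPow_succ (n : ℕ) : loopPow x (n + 1) = loopPow x n ≫ x := pow_succ' (M := End X) _ _
lemma loopPow_succ' (n : ℕ) : loopPow x (n + 1) = x ≫ loopPow x n := pow_succ (M := End X) _ _
lemma loopPow_add (m n : ℕ) : loopPow x m ≫ loopPow x n = loopPow x (m + n) := by
  rw [add_comm]
  exact (pow_add (M := End X) _ _ _).symm

lemma loopPow_comp {y : Y ⟶ Y} {f : X ⟶ Y} (h : x ≫ f = f ≫ y) (n : ℕ) :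
    loopPow x n ≫ f = f ≫ loopPow y n := by
  induction n with
  | zero => simp
  | succ n ih => rw [loopPow_succ, Category.assoc, h, reassoc_of% ih, loopPow_succ]

lemma loopPow_succ_comp_eq_zero {f : X ⟶ Y} (h : x ≫ f = 0) (n : ℕ) :
    loopPow x (n + 1) ≫ f = 0 := by
  rw [loopPow_succ, Category.assoc, h, comp_zero]

/-- The endomorphism `N (1 - x)`, expanded in powers of `x`. -/
def normPoly {X : KohlerCategory p} (x : X ⟶ X) : X ⟶ X :=
  ∑ k ∈ Finset.range p, normCoeff p k • loopPow x k

lemma normSum_eq_normPoly (t : X ⟶ X) (h : t = 𝟙 X - x) : normSum p t = normPoly x := by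
  subst h
  exact sum_one_sub_pow (R := End X) x p

end

lemma a10_a01 : a10 p ε ≫ a01 p ε = normPoly (x0 p ε) :=
  (sound p (.rho2a ε)).trans <| (map_normSum p _).trans <| normSum_eq_normPoly _ _ (gen_t₀ p ε)

lemma a01_a10 : a01 p ε ≫ a10 p ε = normPoly (y1 p ε) :=
  (sound p (.rho2b ε)).trans <| (map_normSum p _).trans <| normSum_eq_normPoly _ _ (gen_s₁ p ε)

lemma normPoly_x2_add_normPoly_y2 :
    normPoly (x2 p ε) + normPoly (y2 p ε) = p • 𝟙 (ob p (A₂ ε)) := by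
  have h := sound p (.rho5 ε)
  rw [Functor.map_add, map_normSum, map_normSum] at h
  refine (congrArg₂ (· + ·) (normSum_eq_normPoly _ _ (gen_t₂ p ε))
    (normSum_eq_normPoly _ _ (gen_s₂ p ε))).symm.trans (h.trans ?_)
  exact ((proj p).mapAddHom (X := kohlerOb (A₂ ε)) (Y := kohlerOb (A₂ ε))).map_nsmul p _

end Relations

end Presentation

/-! ### Spanning sets of the morphism groups -/

section Basis

/-- The index type of the spanning set `basisHom` of `C(X, Y)`. The propositional factor makes it
empty unless `X` and `Y` have the matching suspension flags. For `A₂` the identity is counted among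
the powers of `x₂`, and `y₂ ^ (p - 1)` is left out, as it is expressible through the relation
`N (t₂) + N (s₂) = p`. -/
@[reducible]
def BasisIndex (p : ℕ) : KohlerObj → KohlerObj → Type
  | A₀ ε, A₀ δ => Fin p × PLift (ε = δ)
  | A₀ ε, A₁ δ => PLift (ε = δ)
  | A₀ ε, A₂ δ => Fin (p - 1) × PLift (ε = δ)
  | A₁ ε, A₀ δ => PLift (ε = δ)
  | A₁ ε, A₁ δ => Fin p × PLift (ε = δ)
  | A₁ ε, A₂ δ => Fin (p - 1) × PLift (ε = !δ)
  | A₂ ε, A₀ δ => Fin (p - 1) × PLift (ε = δ)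
  | A₂ ε, A₁ δ => Fin (p - 1) × PLift (δ = !ε)
  | A₂ ε, A₂ δ => (Fin p ⊕ Fin (p - 2)) × PLift (ε = δ)

variable {p : ℕ}

instance finite_basisIndex (X Y : KohlerObj) : Finite (BasisIndex p X Y) := by
  cases X <;> cases Y <;> infer_instance

/-- Generators of `C(X, Y)`; see `basisSpan_eq_top`. -/
def basisHom : ∀ {X Y : KohlerObj}, BasisIndex p X Y → (ob p X ⟶ ob p Y)
  | A₀ ε, A₀ _, (i, ⟨rfl⟩) => loopPow (x0 p ε) i
  | A₀ ε, A₁ _, ⟨rfl⟩ => a10 p ε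
  | A₀ ε, A₂ _, (i, ⟨rfl⟩) => loopPow (x0 p ε) i ≫ a20 p ε
  | A₁ ε, A₀ _, ⟨rfl⟩ => a01 p ε
  | A₁ ε, A₁ _, (i, ⟨rfl⟩) => loopPow (y1 p ε) i
  | A₁ _, A₂ δ, (i, ⟨rfl⟩) => loopPow (y1 p !δ) i ≫ a21 p δ
  | A₂ ε, A₀ _, (i, ⟨rfl⟩) => a02 p ε ≫ loopPow (x0 p ε) i
  | A₂ ε, A₁ _, (i, ⟨rfl⟩) => a12 p ε ≫ loopPow (y1 p !ε) i
  | A₂ ε, A₂ _, (.inl i, ⟨rfl⟩) => loopPow (x2 p ε) i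
  | A₂ ε, A₂ _, (.inr i, ⟨rfl⟩) => loopPow (y2 p ε) (i + 1)

/-- The bijection from the indices for `C(X, Y)` to those for `C(Y, X)`. -/
def BasisIndex.swap : ∀ {X Y : KohlerObj}, BasisIndex p X Y → BasisIndex p Y X
  | A₀ _, A₀ _, (i, ⟨h⟩) => (i, ⟨h.symm⟩)
  | A₀ _, A₁ _, ⟨h⟩ => ⟨h.symm⟩
  | A₀ _, A₂ _, (i, ⟨h⟩) => (i, ⟨h.symm⟩)
  | A₁ _, A₀ _, ⟨h⟩ => ⟨h.symm⟩
  | A₁ _, A₁ _, (i, ⟨h⟩) => (i, ⟨h.symm⟩)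
  | A₁ _, A₂ _, (i, ⟨h⟩) => (i, ⟨h⟩)
  | A₂ _, A₀ _, (i, ⟨h⟩) => (i, ⟨h.symm⟩)
  | A₂ _, A₁ _, (i, ⟨h⟩) => (i, ⟨h⟩)
  | A₂ _, A₂ _, (i, ⟨h⟩) => (i, ⟨h.symm⟩)

lemma BasisIndex.swap_swap {X Y : KohlerObj} (i : BasisIndex p X Y) : i.swap.swap = i := by
  cases X <;> cases Y <;> rfl

/-- The subgroup of `C(X, Y)` generated by the morphisms `basisHom`. -/
def basisSpan (p : ℕ) (X Y : KohlerObj) : Submodule ℤ (ob p X ⟶ ob p Y) :=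
  Submodule.span ℤ (Set.range basisHom)

lemma basisHom_mem {X Y : KohlerObj} (i : BasisIndex p X Y) : basisHom i ∈ basisSpan p X Y :=
  Submodule.subset_span ⟨i, rfl⟩

lemma comp_mem_of_basisHom_comp_mem {X Y Z : KohlerObj} (a : ob p Y ⟶ ob p Z)
    (S : Submodule ℤ (ob p X ⟶ ob p Z))
    (h : ∀ i : BasisIndex p X Y, basisHom i ≫ a ∈ S) :
    ∀ f ∈ basisSpan p X Y, f ≫ a ∈ S := by
  have : basisSpan p X Y ≤ S.comap (Preadditive.rightComp (ob p X) a).toIntLinearMap :=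
    Submodule.span_le.2 (by rintro _ ⟨i, rfl⟩; exact h i)
  exact this

section Powers

section

variable (ε : Bool)

lemma normPoly_comp {X Y : KohlerCategory p} (x : X ⟶ X) (f : X ⟶ Y) :
    normPoly x ≫ f = ∑ k ∈ Finset.range p, normCoeff p k • (loopPow x k ≫ f) := by
  simp [normPoly, Preadditive.sum_comp]

lemma comp_normPoly {X Y : KohlerCategory p} (x : X ⟶ X) (f : Y ⟶ X) :
    f ≫ normPoly x = ∑ k ∈ Finset.range p, normCoeff p k • (f ≫ loopPow x k) := by
  simp [normPoly, Preadditive.comp_sum]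

lemma loopPow_x0_mem {i : ℕ} (hi : i < p) : loopPow (x0 p ε) i ∈ basisSpan p (A₀ ε) (A₀ ε) :=
  basisHom_mem (X := A₀ ε) (Y := A₀ ε) (⟨i, hi⟩, ⟨rfl⟩)

lemma loopPow_y1_mem {i : ℕ} (hi : i < p) : loopPow (y1 p ε) i ∈ basisSpan p (A₁ ε) (A₁ ε) :=
  basisHom_mem (X := A₁ ε) (Y := A₁ ε) (⟨i, hi⟩, ⟨rfl⟩)

lemma loopPow_x2_mem {i : ℕ} (hi : i < p) : loopPow (x2 p ε) i ∈ basisSpan p (A₂ ε) (A₂ ε) :=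
  basisHom_mem (X := A₂ ε) (Y := A₂ ε) (.inl ⟨i, hi⟩, ⟨rfl⟩)

end

variable (hp : 0 < p) (ε : Bool)
include hp

lemma forall_lt_of_sum_normCoeff {G : Type*} [AddCommGroup G] (S : Submodule ℤ G) (φ : ℕ → G)
    (h : ∑ k ∈ Finset.range p, normCoeff p k • φ k ∈ S) (hφ : ∀ k < p - 1, φ k ∈ S)
    {i : ℕ} (hi : i < p) : φ i ∈ S := by
  obtain h' | rfl : i < p - 1 ∨ i = p - 1 := by lia
  · exact hφ i h'
  · exact mem_of_sum_normCoeff_mem S hp φ h hφ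

/-- The power `x₀ ^ (p - 1)` is not among the indices, but `N (t₀) ≫ α₂₀ = α₁₀ ≫ α₀₁ ≫ α₂₀ = 0`
expresses it through the lower powers. -/
lemma loopPow_x0_a20_mem {i : ℕ} (hi : i < p) :
    loopPow (x0 p ε) i ≫ a20 p ε ∈ basisSpan p (A₀ ε) (A₂ ε) := by
  refine forall_lt_of_sum_normCoeff hp _ (fun i => loopPow (x0 p ε) i ≫ a20 p ε) ?_ ?_ hi
  · rw [← normPoly_comp, ← a10_a01, Category.assoc, a01_a20, comp_zero]
    exact Submodule.zero_mem _
  · exact fun k hk => basisHom_mem (X := A₀ ε) (Y := A₂ ε) (⟨k, hk⟩, ⟨rfl⟩)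

lemma loopPow_y1_a21_mem {i : ℕ} (hi : i < p) :
    loopPow (y1 p !ε) i ≫ a21 p ε ∈ basisSpan p (A₁ !ε) (A₂ ε) := by
  refine forall_lt_of_sum_normCoeff hp _ (fun i => loopPow (y1 p !ε) i ≫ a21 p ε) ?_ ?_ hi
  · rw [← normPoly_comp, ← a01_a10, Category.assoc, a10_a21, comp_zero]
    exact Submodule.zero_mem _
  · exact fun k hk => basisHom_mem (X := A₁ !ε) (Y := A₂ ε) (⟨k, hk⟩, ⟨rfl⟩)

lemma a02_loopPow_x0_mem {i : ℕ} (hi : i < p) :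
    a02 p ε ≫ loopPow (x0 p ε) i ∈ basisSpan p (A₂ ε) (A₀ ε) := by
  refine forall_lt_of_sum_normCoeff hp _ (fun i => a02 p ε ≫ loopPow (x0 p ε) i) ?_ ?_ hi
  · rw [← comp_normPoly, ← a10_a01, ← Category.assoc, a02_a10, zero_comp]
    exact Submodule.zero_mem _
  · exact fun k hk => basisHom_mem (X := A₂ ε) (Y := A₀ ε) (⟨k, hk⟩, ⟨rfl⟩)

lemma a12_loopPow_y1_mem {i : ℕ} (hi : i < p) :
    a12 p ε ≫ loopPow (y1 p !ε) i ∈ basisSpan p (A₂ ε) (A₁ !ε) := by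
  refine forall_lt_of_sum_normCoeff hp _ (fun i => a12 p ε ≫ loopPow (y1 p !ε) i) ?_ ?_ hi
  · rw [← comp_normPoly, ← a01_a10, ← Category.assoc, a12_a01, zero_comp]
    exact Submodule.zero_mem _
  · exact fun k hk => basisHom_mem (X := A₂ ε) (Y := A₁ !ε) (⟨k, hk⟩, ⟨rfl⟩)

lemma loopPow_y2_mem {i : ℕ} (hi : i < p) :
    loopPow (y2 p ε) i ∈ basisSpan p (A₂ ε) (A₂ ε) := by
  refine forall_lt_of_sum_normCoeff hp _ (fun i => loopPow (y2 p ε) i) ?_ ?_ hi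
  · have h := normPoly_x2_add_normPoly_y2 p ε
    rw [← eq_sub_iff_add_eq'] at h
    change normPoly (y2 p ε) ∈ _
    rw [h]
    refine Submodule.sub_mem _ (Submodule.smul_of_tower_mem _ _ ?_)
      (Submodule.sum_mem _ fun k hk => Submodule.smul_mem _ _ ?_)
    · simpa using loopPow_x2_mem ε hp
    · exact loopPow_x2_mem ε (Finset.mem_range.1 hk)
  · intro k hk
    obtain _ | k := k
    · simpa using loopPow_x2_mem ε hp
    · exact basisHom_mem (X := A₂ ε) (Y := A₂ ε) (.inr ⟨k, by lia⟩, ⟨rfl⟩)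

end Powers

section Commute
variable (p) (ε : Bool)

lemma x0_a10 : x0 p ε ≫ a10 p ε = 0 := by
  rw [← a20_a02, Category.assoc, a02_a10, comp_zero]
lemma y1_a01 : y1 p (!ε) ≫ a01 p (!ε) = 0 := by
  rw [← a21_a12, Category.assoc, a12_a01, comp_zero]
lemma x0_a20 : x0 p ε ≫ a20 p ε = a20 p ε ≫ x2 p ε := by
  rw [← a20_a02, ← a02_a20, Category.assoc]
lemma y1_a21 : y1 p (!ε) ≫ a21 p ε = a21 p ε ≫ y2 p ε := by
  rw [← a21_a12, ← a12_a21, Category.assoc]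
lemma x2_a02 : x2 p ε ≫ a02 p ε = a02 p ε ≫ x0 p ε := by
  rw [← a20_a02, ← a02_a20, Category.assoc]
lemma y2_a12 : y2 p ε ≫ a12 p ε = a12 p ε ≫ y1 p (!ε) := by
  rw [← a21_a12, ← a12_a21, Category.assoc]
lemma y2_a02 : y2 p ε ≫ a02 p ε = 0 := by
  rw [← a12_a21, Category.assoc, a21_a02, comp_zero]
lemma x2_a12 : x2 p ε ≫ a12 p ε = 0 := by
  rw [← a02_a20, Category.assoc, a20_a12, comp_zero]
lemma x2_y2 : x2 p ε ≫ y2 p ε = 0 := by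
  rw [← a12_a21, ← Category.assoc, x2_a12, zero_comp]

end Commute

section Generators

section

variable (X : KohlerObj) (ε : Bool)

lemma comp_a10_mem : ∀ f ∈ basisSpan p X (A₀ ε), f ≫ a10 p ε ∈ basisSpan p X (A₁ ε) := by
  refine comp_mem_of_basisHom_comp_mem _ _ ?_
  rcases X with δ | δ | δ
  · rintro ⟨⟨_ | i, hi⟩, ⟨rfl⟩⟩
    · change loopPow _ 0 ≫ _ ∈ _
      rw [loopPow_zero, Category.id_comp]
      exact basisHom_mem (X := A₀ δ) (Y := A₁ δ) ⟨rfl⟩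
    · change loopPow _ (i + 1) ≫ _ ∈ _
      rw [loopPow_succ_comp_eq_zero _ (x0_a10 p _)]
      exact Submodule.zero_mem _
  · rintro ⟨rfl⟩
    change a01 p δ ≫ a10 p δ ∈ _
    rw [a01_a10]
    exact Submodule.sum_mem _ fun k hk =>
      Submodule.smul_mem _ _ (loopPow_y1_mem δ (Finset.mem_range.1 hk))
  · rintro ⟨⟨_ | i, hi⟩, ⟨rfl⟩⟩
    · change (a02 p δ ≫ loopPow _ 0) ≫ _ ∈ _
      rw [loopPow_zero, Category.comp_id, a02_a10]
      exact Submodule.zero_mem _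
    · change (a02 p δ ≫ loopPow _ (i + 1)) ≫ _ ∈ _
      rw [Category.assoc, loopPow_succ_comp_eq_zero _ (x0_a10 p _), comp_zero]
      exact Submodule.zero_mem _

lemma comp_a01_mem : ∀ f ∈ basisSpan p X (A₁ ε), f ≫ a01 p ε ∈ basisSpan p X (A₀ ε) := by
  refine comp_mem_of_basisHom_comp_mem _ _ ?_
  rcases X with δ | δ | δ
  · rintro ⟨rfl⟩
    change a10 p δ ≫ a01 p δ ∈ _
    rw [a10_a01]
    exact Submodule.sum_mem _ fun k hk =>
      Submodule.smul_mem _ _ (loopPow_x0_mem δ (Finset.mem_range.1 hk))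
  · rintro ⟨⟨_ | i, hi⟩, ⟨rfl⟩⟩
    · change loopPow _ 0 ≫ _ ∈ _
      rw [loopPow_zero, Category.id_comp]
      exact basisHom_mem (X := A₁ δ) (Y := A₀ δ) ⟨rfl⟩
    · change loopPow _ (i + 1) ≫ _ ∈ _
      obtain ⟨δ, rfl⟩ : ∃ η, δ = !η := ⟨!δ, by simp⟩
      rw [loopPow_succ_comp_eq_zero _ (y1_a01 p _)]
      exact Submodule.zero_mem _
  · rintro ⟨⟨_ | i, hi⟩, ⟨rfl⟩⟩
    · change (a12 p δ ≫ loopPow _ 0) ≫ _ ∈ _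
      rw [loopPow_zero, Category.comp_id, a12_a01]
      exact Submodule.zero_mem _
    · change (a12 p δ ≫ loopPow _ (i + 1)) ≫ _ ∈ _
      rw [Category.assoc, loopPow_succ_comp_eq_zero _ (y1_a01 p _), comp_zero]
      exact Submodule.zero_mem _

end

variable (hp : 0 < p) (X : KohlerObj) (ε : Bool)
include hp

lemma comp_a20_mem : ∀ f ∈ basisSpan p X (A₀ ε), f ≫ a20 p ε ∈ basisSpan p X (A₂ ε) := by
  refine comp_mem_of_basisHom_comp_mem _ _ ?_
  rcases X with δ | δ | δ
  · rintro ⟨⟨i, hi⟩, ⟨rfl⟩⟩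
    exact loopPow_x0_a20_mem hp δ hi
  · rintro ⟨rfl⟩
    change a01 p δ ≫ a20 p δ ∈ _
    rw [a01_a20]
    exact Submodule.zero_mem _
  · rintro ⟨⟨i, hi⟩, ⟨rfl⟩⟩
    change (a02 p δ ≫ loopPow _ i) ≫ _ ∈ _
    rw [Category.assoc, loopPow_comp _ (x0_a20 p δ), ← Category.assoc, a02_a20, ← loopPow_succ']
    exact loopPow_x2_mem δ (by lia)

lemma comp_a21_mem : ∀ f ∈ basisSpan p X (A₁ !ε), f ≫ a21 p ε ∈ basisSpan p X (A₂ ε) := by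
  refine comp_mem_of_basisHom_comp_mem _ _ ?_
  rcases X with δ | δ | δ
  · rintro ⟨rfl⟩
    change a10 p (!ε) ≫ a21 p ε ∈ _
    rw [a10_a21]
    exact Submodule.zero_mem _
  · rintro ⟨⟨i, hi⟩, ⟨rfl⟩⟩
    exact loopPow_y1_a21_mem hp ε hi
  · rintro ⟨⟨i, hi⟩, ⟨h⟩⟩
    obtain rfl := Bool.not_inj h
    change (a12 p ε ≫ loopPow _ i) ≫ _ ∈ _
    rw [Category.assoc, loopPow_comp _ (y1_a21 p ε), ← Category.assoc, a12_a21, ← loopPow_succ']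
    exact loopPow_y2_mem hp ε (by lia)

lemma comp_a02_mem : ∀ f ∈ basisSpan p X (A₂ ε), f ≫ a02 p ε ∈ basisSpan p X (A₀ ε) := by
  refine comp_mem_of_basisHom_comp_mem _ _ ?_
  rcases X with δ | δ | δ
  · rintro ⟨⟨i, hi⟩, ⟨rfl⟩⟩
    change (loopPow _ i ≫ _) ≫ _ ∈ _
    rw [Category.assoc, a20_a02, ← loopPow_succ]
    exact loopPow_x0_mem δ (by lia)
  · rintro ⟨⟨i, hi⟩, ⟨rfl⟩⟩
    change (loopPow _ i ≫ _) ≫ _ ∈ _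
    rw [Category.assoc, a21_a02, comp_zero]
    exact Submodule.zero_mem _
  · rintro ⟨⟨i, hi⟩ | ⟨i, hi⟩, ⟨rfl⟩⟩
    · change loopPow _ i ≫ _ ∈ _
      rw [loopPow_comp _ (x2_a02 p δ)]
      exact a02_loopPow_x0_mem hp δ hi
    · change loopPow _ (i + 1) ≫ _ ∈ _
      rw [loopPow_succ_comp_eq_zero _ (y2_a02 p δ)]
      exact Submodule.zero_mem _

lemma comp_a12_mem : ∀ f ∈ basisSpan p X (A₂ ε), f ≫ a12 p ε ∈ basisSpan p X (A₁ !ε) := by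
  refine comp_mem_of_basisHom_comp_mem _ _ ?_
  rcases X with δ | δ | δ
  · rintro ⟨⟨i, hi⟩, ⟨rfl⟩⟩
    change (loopPow _ i ≫ _) ≫ _ ∈ _
    rw [Category.assoc, a20_a12, comp_zero]
    exact Submodule.zero_mem _
  · rintro ⟨⟨i, hi⟩, ⟨rfl⟩⟩
    change (loopPow _ i ≫ _) ≫ _ ∈ _
    rw [Category.assoc, a21_a12, ← loopPow_succ]
    exact loopPow_y1_mem _ (by lia)
  · rintro ⟨⟨_ | i, hi⟩ | ⟨i, hi⟩, ⟨rfl⟩⟩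
    · change loopPow _ 0 ≫ _ ∈ _
      rw [loopPow_zero, Category.id_comp, ← Category.comp_id (a12 p δ), ← loopPow_zero]
      exact a12_loopPow_y1_mem hp δ hp
    · change loopPow _ (i + 1) ≫ _ ∈ _
      rw [loopPow_succ_comp_eq_zero _ (x2_a12 p δ)]
      exact Submodule.zero_mem _
    · change loopPow _ (i + 1) ≫ _ ∈ _
      rw [loopPow_comp _ (y2_a12 p δ)]
      exact a12_loopPow_y1_mem hp δ (by lia)

/-- By the relations, `t₀`, `s₁`, `t₂` and `s₂` are polynomials in the arrows `αⱼᵢ`, so only the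
latter need a separate argument. -/
lemma comp_gen_mem {Y Z : KohlerObj} (a : KohlerArrow Y Z) :
    ∀ f ∈ basisSpan p X Y, f ≫ gen p a ∈ basisSpan p X Z := by
  intro f hf
  cases a with
  | t₀ ε =>
    rw [gen_t₀, Preadditive.comp_sub, Category.comp_id, ← a20_a02, ← Category.assoc]
    exact Submodule.sub_mem _ hf (comp_a02_mem hp X ε _ (comp_a20_mem hp X ε f hf))
  | s₁ ε =>
    obtain ⟨ε, rfl⟩ : ∃ η, ε = !η := ⟨!ε, by simp⟩
    rw [gen_s₁, Preadditive.comp_sub, Category.comp_id, ← a21_a12, ← Category.assoc]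
    exact Submodule.sub_mem _ hf (comp_a12_mem hp X ε _ (comp_a21_mem hp X ε f hf))
  | s₂ ε =>
    rw [gen_s₂, Preadditive.comp_sub, Category.comp_id, ← a12_a21, ← Category.assoc]
    exact Submodule.sub_mem _ hf (comp_a21_mem hp X ε _ (comp_a12_mem hp X ε f hf))
  | t₂ ε =>
    rw [gen_t₂, Preadditive.comp_sub, Category.comp_id, ← a02_a20, ← Category.assoc]
    exact Submodule.sub_mem _ hf (comp_a20_mem hp X ε _ (comp_a02_mem hp X ε f hf))
  | α₁₀ ε => exact comp_a10_mem X ε f hf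
  | α₂₀ ε => exact comp_a20_mem hp X ε f hf
  | α₀₁ ε => exact comp_a01_mem X ε f hf
  | α₂₁ ε => exact comp_a21_mem hp X ε f hf
  | α₀₂ ε => exact comp_a02_mem hp X ε f hf
  | α₁₂ ε => exact comp_a12_mem hp X ε f hf

lemma basisSpan_eq_top (Y : KohlerObj) : basisSpan p X Y = ⊤ := by
  refine Submodule.eq_top_iff'.2 fun f =>
    mem_of_comp_gen_mem p (basisSpan p X) ?_ (comp_gen_mem hp X) f
  cases X with
  | A₀ ε => simpa using loopPow_x0_mem ε hp
  | A₁ ε => simpa using loopPow_y1_mem ε hp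
  | A₂ ε => simpa using loopPow_x2_mem ε hp

end Generators

end Basis

/-! ### A representation by `2 × 2` matrices -/

section Evaluation

variable {K : Type} [CommRing K] (x : K)

/-- The images of the generators in the `2 × 2` matrices over a ring with an element `x`. The first
coordinate of `A₀` and `A₁` carries the part where `t₀ = 1` and `s₁ = 1`, the second the part where
`N (t₀) = 0` and `N (s₁) = 0`; for `A₂` they are the parts where `s₂ = 1` and `t₂ = 1`. -/
def genMatrix (p : ℕ) : ∀ {X Y : KohlerObj}, KohlerArrow X Y → Matrix (Fin 2) (Fin 2) K
  | _, _, .t₀ _ => !![1, 0; 0, 1 - x]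
  | _, _, .s₁ _ => !![1, 0; 0, 1 - x]
  | _, _, .s₂ _ => !![1, 0; 0, 1 - x]
  | _, _, .t₂ _ => !![1 - x, 0; 0, 1]
  | _, _, .α₁₀ _ => !![1, 0; 0, 0]
  | _, _, .α₂₀ _ => !![0, 1; 0, 0]
  | _, _, .α₀₁ _ => !![(p : K), 0; 0, 0]
  | _, _, .α₂₁ _ => !![0, 0; 0, 1]
  | _, _, .α₀₂ _ => !![0, 0; x, 0]
  | _, _, .α₁₂ _ => !![0, 0; 0, x]

/-- The extension of `genMatrix` to the free `ℤ`-linear category. A composite `f ≫ g` in `SingleObj`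
is the product `g * f`. -/
def genFunctor (p : ℕ) : KohlerFree ⥤ SingleObj (Matrix (Fin 2) (Fin 2) K) :=
  Free.lift ℤ (Paths.lift
    { obj := fun _ => SingleObj.star _
      map := fun a => genMatrix x p a })

lemma genFunctor_map_gen {X Y : KohlerObj} (a : KohlerArrow X Y) :
    (genFunctor x p).map (kohlerGen a) = genMatrix x p a := by
  refine (Free.lift_map_single ℤ _ _ _).trans ?_
  rw [one_smul]
  exact Paths.lift_toPath _ _

variable {p : ℕ} {x}

instance : (genFunctor x p).Additive := Free.lift_additive ..

lemma diag_pow (a b : K) (n : ℕ) : !![a, 0; 0, b] ^ n = !![a ^ n, 0; 0, b ^ n] := by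
  induction n with
  | zero => simp [Matrix.one_fin_two]
  | succ n ih => simp [pow_succ, ih]

lemma sum_diag_pow (a b : K) (s : Finset ℕ) :
    ∑ i ∈ s, !![a, 0; 0, b] ^ i = !![∑ i ∈ s, a ^ i, 0; 0, ∑ i ∈ s, b ^ i] := by
  simp only [diag_pow]
  ext i j
  fin_cases i <;> fin_cases j <;> simp [Matrix.sum_apply]

lemma genFunctor_map_normSum {X : KohlerObj} (a : KohlerArrow X X) :
    (genFunctor x p).map (normSum p (kohlerGen a)) =
      ∑ i ∈ Finset.range p, genMatrix x p a ^ i := by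
  rw [normSum, Functor.map_sum]
  refine Finset.sum_congr rfl fun i _ => ?_
  refine (map_pow ((genFunctor x p).mapEnd _) (show End (kohlerOb X) from kohlerGen a) i).trans ?_
  have h : (genFunctor x p).mapEnd _ (show End (kohlerOb X) from kohlerGen a) =
    genMatrix x p a := genFunctor_map_gen x a
  rw [h]

lemma genFunctor_map_comp_gen {X Y Z : KohlerObj} (a : KohlerArrow X Y) (b : KohlerArrow Y Z) :
    (genFunctor x p).map (kohlerGen a ≫ kohlerGen b) = genMatrix x p b * genMatrix x p a := by
  rw [Functor.map_comp, genFunctor_map_gen, genFunctor_map_gen]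
  rfl

lemma genFunctor_map_rel (hx : ∑ i ∈ Finset.range p, (1 - x) ^ i = 0) {X Y : KohlerFree}
    {f g : X ⟶ Y} (h : KohlerRel p f g) : (genFunctor x p).map f = (genFunctor x p).map g := by
  have h0 {X Y : KohlerFree} : (genFunctor x p).map (0 : X ⟶ Y) = (0 : Matrix _ _ K) :=
    (genFunctor x p).map_zero _ _
  have h1 {X : KohlerFree} : (genFunctor x p).map (𝟙 X) = (1 : Matrix _ _ K) :=
    (genFunctor x p).map_id _
  have hsub {X Y : KohlerFree} {f g : X ⟶ Y} {a b : Matrix (Fin 2) (Fin 2) K}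
      (hf : (genFunctor x p).map f = a) (hg : (genFunctor x p).map g = b) :
      (genFunctor x p).map (f - g) = a - b := by
    subst hf hg; exact (genFunctor x p).map_sub
  have hadd {X Y : KohlerFree} {f g : X ⟶ Y} {a b : Matrix (Fin 2) (Fin 2) K}
      (hf : (genFunctor x p).map f = a) (hg : (genFunctor x p).map g = b) :
      (genFunctor x p).map (f + g) = a + b := by
    subst hf hg; exact (genFunctor x p).map_add
  cases h with
  | rho1a | rho1b | rho1c | rho1d | rho1e | rho1f =>
    rw [genFunctor_map_comp_gen, h0]
    refine Matrix.ext fun i j => ?_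
    fin_cases i <;> fin_cases j <;> simp [genMatrix]
  | rho2a | rho2b =>
    rw [genFunctor_map_comp_gen, genFunctor_map_normSum]
    refine Matrix.ext fun i j => ?_
    fin_cases i <;> fin_cases j <;> simp [genMatrix, sum_diag_pow, hx]
  | rho3a | rho3b | rho4a | rho4b =>
    rw [genFunctor_map_comp_gen, hsub h1 (genFunctor_map_gen x _)]
    refine Matrix.ext fun i j => ?_
    fin_cases i <;> fin_cases j <;> simp [genMatrix]
  | rho5 ε =>
    have hp : (genFunctor x p).map (p • 𝟙 (kohlerOb (A₂ ε))) = (p • 1 : Matrix _ _ K) := by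
      rw [← h1 (X := kohlerOb (A₂ ε))]
      exact ((genFunctor x p).mapAddHom (X := kohlerOb (A₂ ε)) (Y := kohlerOb (A₂ ε))).map_nsmul p _
    rw [hadd (genFunctor_map_normSum _) (genFunctor_map_normSum _), hp]
    refine Matrix.ext fun i j => ?_
    fin_cases i <;> fin_cases j <;> simp [genMatrix, sum_diag_pow, hx]

lemma genFunctor_map_congr (hx : ∑ i ∈ Finset.range p, (1 - x) ^ i = 0) {X Y : KohlerFree}
    {f g : X ⟶ Y} (h : AdditiveCongruence (KohlerRel p) f g) :
    (genFunctor x p).map f = (genFunctor x p).map g := by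
  induction h with
  | of h => exact genFunctor_map_rel hx h
  | refl => rfl
  | symm _ ih => exact ih.symm
  | trans _ _ ih₁ ih₂ => exact ih₁.trans ih₂
  | add _ _ ih₁ ih₂ => rw [Functor.map_add, Functor.map_add, ih₁, ih₂]
  | precomp f _ ih => rw [Functor.map_comp, Functor.map_comp, ih]
  | postcomp g _ ih => rw [Functor.map_comp, Functor.map_comp, ih]

variable (hx : ∑ i ∈ Finset.range p, (1 - x) ^ i = 0)

/-- The representation of Köhler's category by `2 × 2` matrices. -/
def matrixFunctor : KohlerCategory p ⥤ SingleObj (Matrix (Fin 2) (Fin 2) K) :=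
  CategoryTheory.Quotient.lift _ (genFunctor x p) fun _ _ _ _ => genFunctor_map_congr hx

/-- The matrix of a morphism. -/
def mat {X Y : KohlerCategory p} : (X ⟶ Y) →+ Matrix (Fin 2) (Fin 2) K where
  toFun f := (matrixFunctor hx).map f
  map_zero' := (genFunctor x p).map_zero _ _
  map_add' := by
    rintro ⟨f⟩ ⟨g⟩
    exact (genFunctor x p).map_add

lemma mat_comp {X Y Z : KohlerCategory p} (f : X ⟶ Y) (g : Y ⟶ Z) :
    mat hx (f ≫ g) = mat hx g * mat hx f :=
  (matrixFunctor hx).map_comp f g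

lemma mat_id (X : KohlerCategory p) : mat hx (𝟙 X) = 1 :=
  (matrixFunctor hx).map_id X

lemma mat_gen {X Y : KohlerObj} (a : KohlerArrow X Y) : mat hx (gen p a) = genMatrix x p a :=
  genFunctor_map_gen x a

lemma mat_loopPow {X : KohlerCategory p} (f : X ⟶ X) (n : ℕ) :
    mat hx (loopPow f n) = mat hx f ^ n := by
  induction n with
  | zero => rw [loopPow_zero, mat_id, pow_zero]
  | succ n ih => rw [loopPow_succ, mat_comp, ih, pow_succ']

lemma mat_x0 (ε : Bool) : mat hx (x0 p ε) = !![0, 0; 0, x] := by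
  rw [x0, map_sub, mat_id, mat_gen]
  ext i j
  fin_cases i <;> fin_cases j <;> simp [genMatrix]

lemma mat_y1 (ε : Bool) : mat hx (y1 p ε) = !![0, 0; 0, x] := by
  rw [y1, map_sub, mat_id, mat_gen]
  ext i j
  fin_cases i <;> fin_cases j <;> simp [genMatrix]

lemma mat_x2 (ε : Bool) : mat hx (x2 p ε) = !![x, 0; 0, 0] := by
  rw [x2, map_sub, mat_id, mat_gen]
  ext i j
  fin_cases i <;> fin_cases j <;> simp [genMatrix]

lemma mat_y2 (ε : Bool) : mat hx (y2 p ε) = !![0, 0; 0, x] := by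
  rw [y2, map_sub, mat_id, mat_gen]
  ext i j
  fin_cases i <;> fin_cases j <;> simp [genMatrix]

/-- The difference of the two diagonal entries of the matrix of an endomorphism, under `μ`. -/
def superTrace (μ : K →+ ℚ) (X : KohlerCategory p) : (X ⟶ X) →+ ℚ where
  toFun f := μ (mat hx f 0 0) - μ (mat hx f 1 1)
  map_zero' := by simp
  map_add' f g := by simp only [map_add, Matrix.add_apply]; ring

end Evaluation

/-! ### The nondegenerate form -/

section Form

variable {p : ℕ}

/-- On `1, x, ..., x ^ (p - 1)` the additive functional `l` picks out, up to a sign, the coefficient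
of `x ^ (p - 1)`. -/
structure IsTopCoefficient {X : KohlerCategory p} (l : (X ⟶ X) →+ ℤ) (x : X ⟶ X) : Prop where
  eq_zero (n : ℕ) (h : n < p - 1) : l (loopPow x n) = 0
  isUnit : IsUnit (l (loopPow x (p - 1)))

/-- Conditions on the values of a family of functionals on the endomorphism rings that make all
composition pairings perfect; see `IsNondegenerateForm.isUnit_det`. -/
structure IsNondegenerateForm (form : ∀ X : KohlerCategory p, (X ⟶ X) →+ ℤ) : Prop where
  top_x0 (ε : Bool) : IsTopCoefficient (form _) (x0 p ε)
  top_y1 (ε : Bool) : IsTopCoefficient (form _) (y1 p ε)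
  top_x2 (ε : Bool) : IsTopCoefficient (form _) (x2 p ε)
  top_y2 (ε : Bool) : IsTopCoefficient (form _) (y2 p ε)
  isUnit_a10_a01 (ε : Bool) : IsUnit (form _ (a10 p ε ≫ a01 p ε))
  isUnit_a01_a10 (ε : Bool) : IsUnit (form _ (a01 p ε ≫ a10 p ε))

/-- Integrality may be checked on the spanning set. -/
lemma exists_form_eq {p : ℕ} (hp : 0 < p) {X : KohlerObj} (l : (ob p X ⟶ ob p X) →+ ℚ)
    (h : ∀ i : BasisIndex p X X, ∃ m : ℤ, l (basisHom i) = m) (f : ob p X ⟶ ob p X) :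
    ∃ m : ℤ, (m : ℚ) = l f := by
  have hf : f ∈ basisSpan p X X := basisSpan_eq_top hp X X ▸ trivial
  have : basisSpan p X X ≤
      (LinearMap.range (Int.castAddHom ℚ).toIntLinearMap).comap l.toIntLinearMap :=
    Submodule.span_le.2 (by rintro _ ⟨i, rfl⟩; exact (h i).imp fun _ => Eq.symm)
  exact this hf

lemma exists_int_form {G : Type*} [AddCommGroup G] (l : G →+ ℚ) (h : ∀ f, ∃ m : ℤ, (m : ℚ) = l f) :
    ∃ l' : G →+ ℤ, ∀ f, (l' f : ℚ) = l f := by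
  choose φ hφ using h
  refine ⟨AddMonoidHom.mk' φ fun f g => ?_, hφ⟩
  exact_mod_cast (by push_cast; rw [hφ, hφ, hφ, map_add] :
    ((φ (f + g) : ℤ) : ℚ) = ((φ f + φ g : ℤ) : ℚ))

theorem exists_isNondegenerateForm (hp : 2 ≤ p) :
    ∃ form : ∀ X : KohlerCategory p, (X ⟶ X) →+ ℤ, IsNondegenerateForm form := by
  obtain ⟨K, _, x, μ, hx, hμ, hμ', hμ1⟩ := exists_normCoeff_functional p hp
  -- `μ 1` is not an integer, but the two diagonal entries of the identity cancel
  have hone (X : KohlerCategory p) : superTrace hx μ X (𝟙 X) = 0 := by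
    simp [superTrace, mat_id]
  have hlow {X : KohlerCategory p} {f : X ⟶ X} (hf : mat hx f = !![0, 0; 0, x]) {n : ℕ}
      (hn : 1 ≤ n) : superTrace hx μ X (loopPow f n) = - μ (x ^ n) := by
    simp [superTrace, mat_loopPow, hf, diag_pow, zero_pow (by lia : n ≠ 0)]
  have hupp {X : KohlerCategory p} {f : X ⟶ X} (hf : mat hx f = !![x, 0; 0, 0]) {n : ℕ}
      (hn : 1 ≤ n) : superTrace hx μ X (loopPow f n) = μ (x ^ n) := by
    simp [superTrace, mat_loopPow, hf, diag_pow, zero_pow (by lia : n ≠ 0)]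
  have hμp : μ p = -normCoeff p (p - 1) := by
    rw [← hμ1, ← nsmul_eq_mul, ← map_nsmul, nsmul_one]
  have h1001 (ε : Bool) : superTrace hx μ _ (a10 p ε ≫ a01 p ε) = -normCoeff p (p - 1) := by
    simp [superTrace, mat_comp, mat_gen, genMatrix, hμp]
  have h0110 (ε : Bool) : superTrace hx μ _ (a01 p ε ≫ a10 p ε) = -normCoeff p (p - 1) := by
    simp [superTrace, mat_comp, mat_gen, genMatrix, hμp]
  have hint {n : ℕ} (hn : 1 ≤ n) (h : n < p) : ∃ m : ℤ, μ (x ^ n) = m := by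
    obtain h | rfl : n < p - 1 ∨ n = p - 1 := by lia
    · exact ⟨0, by rw [hμ n hn h, Int.cast_zero]⟩
    · exact ⟨1, by rw [hμ', Int.cast_one]⟩
  have hlow' {X : KohlerCategory p} {f : X ⟶ X} (hf : mat hx f = !![0, 0; 0, x]) {n : ℕ}
      (h : n < p) : ∃ m : ℤ, superTrace hx μ X (loopPow f n) = m := by
    obtain rfl | hn := Nat.eq_zero_or_pos n
    · exact ⟨0, by rw [loopPow_zero, hone, Int.cast_zero]⟩
    · obtain ⟨m, hm⟩ := hint hn h
      exact ⟨-m, by rw [hlow hf hn, hm, Int.cast_neg]⟩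
  have hupp' {X : KohlerCategory p} {f : X ⟶ X} (hf : mat hx f = !![x, 0; 0, 0]) {n : ℕ}
      (h : n < p) : ∃ m : ℤ, superTrace hx μ X (loopPow f n) = m := by
    obtain rfl | hn := Nat.eq_zero_or_pos n
    · exact ⟨0, by rw [loopPow_zero, hone, Int.cast_zero]⟩
    · obtain ⟨m, hm⟩ := hint hn h
      exact ⟨m, by rw [hupp hf hn, hm]⟩
  have hform (X : KohlerCategory p) :
      ∃ l : (X ⟶ X) →+ ℤ, ∀ f, (l f : ℚ) = superTrace hx μ X f := by
    refine exists_int_form _ (exists_form_eq (X := X.as) (by lia) (superTrace hx μ X) ?_)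
    rcases X with ⟨ε | ε | ε⟩
    · rintro ⟨⟨i, hi⟩, ⟨_⟩⟩
      exact hlow' (mat_x0 hx ε) hi
    · rintro ⟨⟨i, hi⟩, ⟨_⟩⟩
      exact hlow' (mat_y1 hx ε) hi
    · rintro ⟨⟨i, hi⟩ | ⟨i, hi⟩, ⟨_⟩⟩
      · exact hupp' (mat_x2 hx ε) hi
      · exact hlow' (mat_y2 hx ε) (by lia)
  choose form hform using hform
  have htop {X : KohlerCategory p} {f : X ⟶ X}
      (h : mat hx f = !![0, 0; 0, x] ∨ mat hx f = !![x, 0; 0, 0]) :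
      IsTopCoefficient (form X) f := by
    constructor
    · intro n hn
      rw [← Int.cast_eq_zero (α := ℚ), hform]
      obtain rfl | hn' := Nat.eq_zero_or_pos n
      · rw [loopPow_zero, hone]
      · obtain h | h := h
        · rw [hlow h hn', hμ n hn' hn, neg_zero]
        · rw [hupp h hn', hμ n hn' hn]
    · rw [Int.isUnit_iff]
      obtain h | h := h
      · right
        rw [← Int.cast_inj (α := ℚ), hform, hlow h (by lia), hμ', Int.cast_neg, Int.cast_one]
      · left
        rw [← Int.cast_inj (α := ℚ), hform, hupp h (by lia), hμ', Int.cast_one]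
  have hunit {X : KohlerCategory p} {f : X ⟶ X}
      (h : superTrace hx μ X f = -normCoeff p (p - 1)) : IsUnit (form X f) := by
    have : form X f = -normCoeff p (p - 1) := by
      rw [← Int.cast_inj (α := ℚ), hform, h, Int.cast_neg]
    rw [this]
    exact (isUnit_normCoeff_sub_one (by lia)).neg
  exact ⟨form, fun ε => htop (.inl (mat_x0 hx ε)), fun ε => htop (.inl (mat_y1 hx ε)),
    fun ε => htop (.inr (mat_x2 hx ε)), fun ε => htop (.inl (mat_y2 hx ε)),
    fun ε => hunit (h1001 ε), fun ε => hunit (h0110 ε)⟩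

end Form

/-! ### The Gram matrices of Köhler's category -/

section Gram

variable {p : ℕ}

lemma IsTopCoefficient.isUnit_det {X : KohlerCategory p} {l : (X ⟶ X) →+ ℤ} {x : X ⟶ X}
    (h : IsTopCoefficient l x) {n c : ℕ} (hnc : n + c = p) (M : Matrix (Fin n) (Fin n) ℤ)
    (hM : ∀ i j : Fin n, M i j = l (loopPow x (i + j + c))) : IsUnit M.det := by
  obtain rfl : M = Matrix.of fun i j : Fin n => l (loopPow x (i + j + c)) := Matrix.ext hM
  refine isUnit_det_hankel n c (fun k => l (loopPow x k)) (fun k _ hk => h.eq_zero k (by lia))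
    fun k hk => ?_
  obtain rfl : k = p - 1 := by lia
  exact h.isUnit

lemma loopPow_comp_comp_loopPow {X Y : KohlerCategory p} {x : X ⟶ X} {a : X ⟶ Y} {b : Y ⟶ X}
    (h : a ≫ b = x) (i j : ℕ) :
    (loopPow x i ≫ a) ≫ b ≫ loopPow x j = loopPow x (i + j + 1) := by
  rw [Category.assoc, reassoc_of% h, ← loopPow_succ', loopPow_add]
  rfl

lemma comp_loopPow_comp_loopPow_comp {X Y : KohlerCategory p} {x : X ⟶ X} {y : Y ⟶ Y}
    {a : X ⟶ Y} {b : Y ⟶ X} (hx : b ≫ a = y) (h : x ≫ a = a ≫ y) (i j : ℕ) :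
    (b ≫ loopPow x i) ≫ loopPow x j ≫ a = loopPow y (i + j + 1) := by
  rw [Category.assoc, ← Category.assoc (loopPow x i), loopPow_add, loopPow_comp _ h,
    ← Category.assoc, hx, ← loopPow_succ']

variable {form : ∀ X : KohlerCategory p, (X ⟶ X) →+ ℤ}

/-- Up to the shape of the index, every Gram matrix is a Hankel matrix `form (x ^ (i + j + c))` for
one of the loops, except for the `1 × 1` matrices between `A₀` and `A₁` and for `A₂`, where it is
block triangular with a block for `x₂` and one for `y₂`. -/
lemma IsNondegenerateForm.isUnit_det (h : IsNondegenerateForm form) (hp : 2 ≤ p)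
    (X W : KohlerObj) [Fintype (BasisIndex p X W)] [DecidableEq (BasisIndex p X W)] :
    IsUnit (Matrix.of fun i j : BasisIndex p X W =>
      form (ob p X) (basisHom i ≫ basisHom j.swap)).det := by
  have hp1 : p - 1 + 1 = p := by lia
  have hp2 : p - 2 + 2 = p := by lia
  rcases X with ε | ε | ε <;> rcases W with δ | δ | δ
  · refine isUnit_det_prod_plift _ ?_
    rintro rfl
    exact (h.top_x0 ε).isUnit_det (add_zero p) _ fun i j => congrArg (form _) (loopPow_add _ _ _)
  · refine isUnit_det_plift _ ?_
    rintro rfl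
    exact h.isUnit_a10_a01 ε
  · refine isUnit_det_prod_plift _ ?_
    rintro rfl
    exact (h.top_x0 ε).isUnit_det hp1 _ fun i j =>
      congrArg (form _) (loopPow_comp_comp_loopPow (a20_a02 p ε) _ _)
  · refine isUnit_det_plift _ ?_
    rintro rfl
    exact h.isUnit_a01_a10 ε
  · refine isUnit_det_prod_plift _ ?_
    rintro rfl
    exact (h.top_y1 ε).isUnit_det (add_zero p) _ fun i j => congrArg (form _) (loopPow_add _ _ _)
  · refine isUnit_det_prod_plift _ ?_
    rintro rfl
    exact (h.top_y1 !δ).isUnit_det hp1 _ fun i j =>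
      congrArg (form _) (loopPow_comp_comp_loopPow (a21_a12 p δ) _ _)
  · refine isUnit_det_prod_plift _ ?_
    rintro rfl
    exact (h.top_x2 ε).isUnit_det hp1 _ fun i j =>
      congrArg (form _) (comp_loopPow_comp_loopPow_comp (a02_a20 p ε) (x0_a20 p ε) _ _)
  · refine isUnit_det_prod_plift _ ?_
    rintro rfl
    exact (h.top_y2 ε).isUnit_det hp1 _ fun i j =>
      congrArg (form _) (comp_loopPow_comp_loopPow_comp (a12_a21 p ε) (y1_a21 p ε) _ _)
  · refine isUnit_det_prod_plift _ ?_
    rintro rfl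
    refine isUnit_det_sum _ ?_ ?_ ?_
    · refine Matrix.ext fun i j => ?_
      -- `y₂ ^ (j + 1)` is of too low a degree, and `x₂ ^ (i + 1) ≫ y₂ ^ (j + 1) = 0`
      obtain ⟨_ | i, hi⟩ := i
      · refine (congrArg (form _) (Category.id_comp (loopPow (y2 p ε) (j + 1)))).trans ?_
        exact (h.top_y2 ε).eq_zero _ (by lia)
      · refine (congrArg (form _) ?_).trans (map_zero _)
        change loopPow (x2 p ε) (i + 1) ≫ loopPow (y2 p ε) (j + 1) = 0
        rw [loopPow_succ' (y2 p ε), ← Category.assoc,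
          loopPow_succ_comp_eq_zero _ (x2_y2 p ε), zero_comp]
    · exact (h.top_x2 ε).isUnit_det (add_zero p) _ fun i j => congrArg (form _) (loopPow_add _ _ _)
    · refine (h.top_y2 ε).isUnit_det hp2 _ fun i j =>
        congrArg (form _) ((loopPow_add _ _ _).trans ?_)
      congr 1
      lia

/-- The Frobenius form on Köhler's category given by a nondegenerate family of functionals. -/
def IsNondegenerateForm.frobeniusForm (h : IsNondegenerateForm form) (hp : 2 ≤ p) :
    FrobeniusForm (KohlerCategory p) :=
  letI (X W : KohlerCategory p) : Fintype (BasisIndex p X.as W.as) :=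
    @Fintype.ofFinite _ (finite_basisIndex X.as W.as)
  letI (X W : KohlerCategory p) : DecidableEq (BasisIndex p X.as W.as) := Classical.decEq _
  FrobeniusForm.ofGram form (fun X W => BasisIndex p X.as W.as) basisHom
    (fun i => basisHom i.swap) (fun X W => basisSpan_eq_top (by lia) X.as W.as)
    (fun X W => by
      refine Eq.trans ?_ (basisSpan_eq_top (by lia) W.as X.as)
      refine congrArg (Submodule.span ℤ) ?_
      exact (Function.LeftInverse.surjective fun i => BasisIndex.swap_swap i).range_comp basisHom)
    fun X W => h.isUnit_det hp X.as W.as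

instance : Finite KohlerObj :=
  Finite.of_surjective (fun a : Bool × Fin 3 => match a with
    | (ε, 0) => A₀ ε
    | (ε, 1) => A₁ ε
    | (ε, 2) => A₂ ε) <| by
    rintro (ε | ε | ε)
    exacts [⟨(ε, 0), rfl⟩, ⟨(ε, 1), rfl⟩, ⟨(ε, 2), rfl⟩]

instance : Finite (KohlerCategory p) :=
  Finite.of_surjective (ob p) fun X => ⟨X.as, rfl⟩

end Gram

end KohlerCategory

end

theorem theorem9p12 (p : ℕ) (hp : p.Prime) : IsNGorenstein (KohlerCategory p) 1 := by
  obtain ⟨form, h⟩ := KohlerCategory.exists_isNondegenerateForm hp.two_le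
  -- the functional on `End A₂` takes the value `1` at `x₂ ^ (p - 1)` or its negative
  have hu := (h.top_x2 false).isUnit
  obtain hu | hu := Int.isUnit_iff.1 hu
  · exact (h.frobeniusForm hp.two_le).isNGorenstein_one _ _ hu
  · refine (h.frobeniusForm hp.two_le).isNGorenstein_one (KohlerCategory.ob p (A₂ false))
      (-KohlerCategory.loopPow (KohlerCategory.x2 p false) (p - 1)) ?_
    refine (map_neg (form _) _).trans ?_
    rw [hu, neg_neg]
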